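/- Let $\xi$ and $\eta$ be random vectors with values in $\mathbb{R}^p$ and $\mathbb{R}^q$ on a probability space $(\Omega,\mathcal F,\mathrm P)$ such that $(\xi,\eta)$ is a Gaussian random vector, the covariance matrices $R_\xi$ and $R_\eta$ are nonsingular, and the joint distribution $\mathrm P_{\xi\eta}$ is absolutely continuous with respect to $\mathrm P_\xi\otimes\mathrm P_\eta$. Let $i(\xi;\eta)=\log\frac{d\mathrm P_{\xi\eta}}{d(\mathrm P_\xi\otimes \mathrm P_\eta)}(\xi,\eta)$ be the information density and $I=I(\xi;\eta)=\mathrm E[i(\xi;\eta)]$ the mutual information. Let $r\ge 1$ be the rank of the cross-covariance matrix $R_{\xi\eta}$, and let $\rho_1\ge\dots\ge\rho_r>0$ be the canonical correlations of $\xi$ and $\eta$, i.e. the positive singular values of $R_\xi^{-1/2}R_{\xi\eta}R_\eta^{-1/2}$. Suppose that $\rho_1=\rho_2=\dots=\rho_r$. Then $0<\rho_r<1$, the expectation defining $I$ exists, $I=-\frac r2\log(1-\rho_r^2)$, and the following holds. (i) The distribution of $i(\xi;\eta)$ has a probability density function $f$ that is continuous on $\mathbb{R}\setminus\{I\}$ and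 satisfies $$f(x)=\frac{1}{\rho_r\sqrt{\pi}\,\Gamma(\frac r2)}\,K_{\frac{r-1}{2}}\!\left(\left|\frac{x-I}{\rho_r}\right|\right)\left|\frac{x-I}{2\rho_r}\right|^{\frac{r-1}{2}},\qquad x\in\mathbb{R}\setminus\{I\},$$ where $K_\alpha$ is the modified Bessel function of the second kind of order $\alpha$. If $r\ge2$, then $f$ is also well defined at $x=I$: it extends continuously there, with the value $f(I)=\frac{\Gamma(\frac{r-1}{2})}{2\rho_r\sqrt{\pi}\,\Gamma(\frac r2)}$. (ii) For all $x\in\mathbb{R}$, the cumulative distribution function of $i(\xi;\eta)$ is $$F(x)=\begin{cases}\frac12-V(I-x)& \text{if } x\le I,\\ \frac12+V(x-I)&\text{if } x>I,\end{cases}$$ where, with $L_\alpha$ the modified Struve $L$ function of order $\alpha$, $$V(z)=\frac{z}{2\rho_r}\left[K_{\frac{r-1}{2}}\!\left(\tfrac{z}{\rho_r}\right)L_{\frac{r-3}{2}}\!\left(\tfrac{z}{\rho_r}\right)+K_{\frac{r-3}{2}}\!\left(\tfrac{z}{\rho_r}\right)L_{\frac{r-1}{2}}\!\left(\tfrac{z}{\rho_r}\right)\right],\qquad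 z>0,$$ and $V(0)=\lim_{z\downarrow0}V(z)=0$. (iii) All central moments of $i(\xi;\eta)$ exist, and for every integer $m\ge1$ $$\mathrm E\big[(i(\xi;\eta)-I)^m\big]=\begin{cases}\dfrac{m!}{(m/2)!}\left(\displaystyle\prod_{j=1}^{m/2}\Big(\frac r2+j-1\Big)\right)\rho_r^{\,m}&\text{if } m \text{ is even},\\[1ex] 0&\text{if } m \text{ is odd}.\end{cases}$$ -/

import Mathlib

noncomputable section

open MeasureTheory ProbabilityTheory

namespace GaussInfo

section Info

variable {Ω E F : Type*} [MeasurableSpace Ω] [MeasurableSpace E] [MeasurableSpace F]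

/-- The information density `i(X;Y) = log (dP_{XY} / d(P_X ⊗ P_Y)) (X, Y)`, a real random variable
on `Ω` (`llr μ ν` is the logarithm of the Radon-Nikodym derivative `dμ/dν`). -/
def infoDensity (P : Measure Ω) (X : Ω → E) (Y : Ω → F) (ω : Ω) : ℝ :=
  llr (P.map (fun ω' => (X ω', Y ω'))) ((P.map X).prod (P.map Y)) (X ω, Y ω)

/-- The mutual information `I(X;Y)`: the expectation of the information density. -/
def mutualInfo (P : Measure Ω) (X : Ω → E) (Y : Ω → F) : ℝ :=
  ∫ ω, infoDensity P X Y ω ∂P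

end Info

section CCA

variable {Ω : Type*} [MeasurableSpace Ω] {p q : ℕ}

/-- The cross-covariance matrix `R_{XY}`; `crossCov P X X` is the covariance matrix `R_X`. -/
def crossCov (P : Measure Ω) (X : Ω → EuclideanSpace ℝ (Fin p))
    (Y : Ω → EuclideanSpace ℝ (Fin q)) : Matrix (Fin p) (Fin q) ℝ :=
  Matrix.of fun i j => cov[fun ω => X ω i, fun ω => Y ω j; P]

open scoped MatrixOrder in
/-- The matrix `M = R_X^{-1/2} R_{XY} R_Y^{-1/2}`, with positive semidefinite square roots. -/
def coherenceMatrix (P : Measure Ω) (X : Ω → EuclideanSpace ℝ (Fin p))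
    (Y : Ω → EuclideanSpace ℝ (Fin q)) : Matrix (Fin p) (Fin q) ℝ :=
  (CFC.sqrt (crossCov P X X))⁻¹ * crossCov P X Y * (CFC.sqrt (crossCov P Y Y))⁻¹

/-- The canonical correlations of `X` and `Y`: the singular values of
`R_X^{-1/2} R_{XY} R_Y^{-1/2}` in descending order, with multiplicity. Indices start at `0`, so the
positive ones are those with index `i < rank R_{XY}`; all further ones are `0`. -/
def canonicalCorr (P : Measure Ω) (X : Ω → EuclideanSpace ℝ (Fin p))
    (Y : Ω → EuclideanSpace ℝ (Fin q)) (i : ℕ) : ℝ :=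
  (Matrix.toEuclideanLin (coherenceMatrix P X Y)).singularValues i

end CCA

/-- The modified Bessel function of the second kind of real order `α`, at real `x > 0`:
`K_α(x) = ∫_0^∞ exp(-x cosh t) cosh(α t) dt`. -/
def besselK (α x : ℝ) : ℝ :=
  ∫ t in Set.Ioi (0 : ℝ), Real.exp (-(x * Real.cosh t)) * Real.cosh (α * t)

/-- The modified Struve function of real order `α ≥ -1`, at real `x ≥ 0`:
`L_α(x) = (x/2)^(α+1) ∑_n (x/2)^(2n) / (Γ(n+3/2) Γ(n+α+3/2))`. -/
def struveL (α x : ℝ) : ℝ :=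
  (x / 2) ^ (α + 1) *
    ∑' n : ℕ, (x / 2) ^ (2 * n) / (Real.Gamma (n + 3 / 2) * Real.Gamma (n + α + 3 / 2))

/-- The function `V(z) = z/(2ρ) [K_{(r-1)/2}(z/ρ) L_{(r-3)/2}(z/ρ) + K_{(r-3)/2}(z/ρ)
L_{(r-1)/2}(z/ρ)]` for `z > 0`; the formula has the limit `0` as `z` tends to `0` from the right,
and its value here at `z = 0` is `0`. -/
def equalCorrV (r : ℕ) (ρ z : ℝ) : ℝ :=
  z / (2 * ρ) *
    (besselK (((r : ℝ) - 1) / 2) (z / ρ) * struveL (((r : ℝ) - 3) / 2) (z / ρ) +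
      besselK (((r : ℝ) - 3) / 2) (z / ρ) * struveL (((r : ℝ) - 1) / 2) (z / ρ))

end GaussInfo

end

noncomputable section

open MeasureTheory ProbabilityTheory Filter Topology

namespace GaussInfo

/-! ### The modified Bessel function: bounds, recurrence, derivatives. -/

section Bessel

/-! The information density is, up to an additive constant, a difference of two independent, equally
scaled chi-squared variables; that law is a variance-gamma law, from which the density, the
distribution function and the moments can be read off.

Whitening both vectors and decomposing the coherence matrix, which is `ρ` times a partial isometry
because its positive singular values agree, yields canonical variables `S = Aᵀx` and `T = Bᵀy` in
dimension `r`: each is standard normal and their cross-covariance is `ρ` times the identity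
(`exists_canonical`, `exists_isCanonical`). If `ρ = 1`, then `S = T` almost surely, so the joint law
would charge a null set of the product law; absolute continuity excludes this. For `ρ < 1`, the
residual `Z = y - R_y B T` is uncorrelated with `x` and with `T`. Hence `x` acts on `y` only through
`T = ρS + √(1 - ρ²) W`, and the Radon-Nikodym derivative is a product of `r` bivariate normal
density ratios (`map_prodMk_eq_withDensity`, `IsCanonical.map_eq_withDensity`). Its logarithm is
`-(r/2) log (1 - ρ²)` plus a quadratic form in `(S, T)`.

Normalizing `S + T` and `S - T` diagonalizes this form into `(ρ/2) ∑ (U_i² - V_i²)` with `2r`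
independent standard normals (`IsCanonical.map_quadratic`). The characteristic function is `(1 +
ρ²s²)^(-r/2)`, which is also that of `ρ√G N` with `G` gamma distributed of shape `r/2` and rate
`1/2`, and `N` an independent standard normal (`map_sum_sq_sub_sq`, `charFun_varGamma`).

The mixture representation settles the rest. Integrating the Gaussian density over the variance
gives the Bessel function (`varGamma_eq_withDensity`); the moments factor into moments of `G` and of
`N`; and evenness in `ρ` makes the law symmetric, so the constant is the mean. For the distribution
function, the recurrences of `K` and `L` show that `V` is an antiderivative of the density on the
positive axis with limit `0` at the origin (`hasDerivAt_equalCorrV`, `tendsto_equalCorrV`). -/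

lemma integrableOn_rpow_mul_exp_neg_mul_Ioi {a b : ℝ} (ha : 0 < a) (hb : 0 < b) :
    IntegrableOn (fun u : ℝ => u ^ (a - 1) * Real.exp (-(b * u))) (Set.Ioi 0) := by
  have h := integrableOn_rpow_mul_exp_neg_mul_rpow (p := 1) (s := a - 1) (by linarith)
    one_pos hb
  simpa [Real.rpow_one, neg_mul] using h

/-- The substitution `u = exp t` turns this into a gamma integral. -/
lemma integrable_exp_mul_exp_neg_exp {a b : ℝ} (ha : 0 < a) (hb : 0 < b) :
    Integrable (fun t : ℝ => Real.exp (a * t) * Real.exp (-(b * Real.exp t))) := by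
  have h := (integrableOn_image_iff_integrableOn_abs_deriv_smul (s := Set.univ) (f := Real.exp)
    (f' := Real.exp) MeasurableSet.univ (fun x _ => (Real.hasDerivAt_exp x).hasDerivWithinAt)
    Real.exp_injective.injOn (fun u => u ^ (a - 1) * Real.exp (-(b * u)))).1
  rw [Set.image_univ, Real.range_exp, integrableOn_univ] at h
  have h' := h (integrableOn_rpow_mul_exp_neg_mul_Ioi ha hb)
  refine h'.congr (ae_of_all _ fun t => ?_)
  simp only [smul_eq_mul, abs_of_pos (Real.exp_pos t), ← mul_assoc]
  rw [← Real.exp_mul, ← Real.exp_add]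
  ring_nf

lemma integral_exp_mul_exp_neg_exp {a b : ℝ} (ha : 0 < a) (hb : 0 < b) :
    ∫ t : ℝ, Real.exp (a * t) * Real.exp (-(b * Real.exp t)) = (1 / b) ^ a * Real.Gamma a := by
  have h := (integral_image_eq_integral_abs_deriv_smul (s := Set.univ) (f := Real.exp)
    (f' := Real.exp) MeasurableSet.univ (fun x _ => (Real.hasDerivAt_exp x).hasDerivWithinAt)
    Real.exp_injective.injOn (fun u => u ^ (a - 1) * Real.exp (-(b * u))))
  rw [Set.image_univ, Real.range_exp, Measure.restrict_univ,
    Real.integral_rpow_mul_exp_neg_mul_Ioi ha hb] at h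
  rw [h]
  congr 1 with t
  have : Real.exp (a * t) = Real.exp t * Real.exp (t * (a - 1)) := by
    rw [← Real.exp_add]
    ring_nf
  simp only [smul_eq_mul, abs_of_pos (Real.exp_pos t), ← mul_assoc, ← Real.exp_mul, this]

lemma half_exp_le_cosh (t : ℝ) : Real.exp t / 2 ≤ Real.cosh t := by
  rw [Real.cosh_eq]
  have := Real.exp_pos (-t)
  linarith

lemma exp_neg_mul_cosh_le {x : ℝ} (hx : 0 < x) (t : ℝ) :
    Real.exp (-(x * Real.cosh t)) ≤ Real.exp (-(x / 2 * Real.exp t)) := by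
  apply Real.exp_le_exp.2
  have := mul_le_mul_of_nonneg_left (half_exp_le_cosh t) hx.le
  linarith

lemma integrable_exp_mul_exp_neg_cosh (a : ℝ) {x : ℝ} (hx : 0 < x) :
    Integrable (fun t : ℝ => Real.exp (a * t) * Real.exp (-(x * Real.cosh t))) := by
  have h1 : ∀ b : ℝ, 0 < b →
      Integrable (fun t : ℝ => Real.exp (b * t) * Real.exp (-(x * Real.cosh t))) := by
    intro b hb
    refine (integrable_exp_mul_exp_neg_exp hb (half_pos hx)).mono' (by fun_prop)
      (ae_of_all _ fun t => ?_)
    rw [Real.norm_of_nonneg (by positivity)]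
    exact mul_le_mul_of_nonneg_left (exp_neg_mul_cosh_le hx t) (Real.exp_pos _).le
  -- The case of positive exponent is used at `|a| + 1`, positive also for `a = 0`; since `cosh` is
  -- even, its reflection covers negative `t`.
  have hb : 0 < |a| + 1 := by positivity
  have h2 := (h1 _ hb).comp_neg
  refine ((h1 _ hb).add h2).mono' (by fun_prop) (ae_of_all _ fun t => ?_)
  rw [Real.norm_of_nonneg (by positivity)]
  simp only [Pi.add_apply, Real.cosh_neg, ← add_mul]
  refine mul_le_mul_of_nonneg_right ?_ (Real.exp_pos _).le
  have h3 : a * t ≤ (|a| + 1) * |t| := by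
    calc a * t ≤ |a * t| := le_abs_self _
      _ = |a| * |t| := abs_mul _ _
      _ ≤ _ := by nlinarith [abs_nonneg t]
  have hp := Real.exp_pos ((|a| + 1) * t)
  have hm := Real.exp_pos ((|a| + 1) * (-t))
  rcases le_total 0 t with ht | ht
  · rw [abs_of_nonneg ht] at h3
    have := Real.exp_le_exp.2 h3
    linarith
  · rw [abs_of_nonpos ht] at h3
    have := Real.exp_le_exp.2 h3
    linarith

lemma integrable_exp_neg_cosh_mul_cosh (a : ℝ) {x : ℝ} (hx : 0 < x) :
    Integrable (fun t : ℝ => Real.exp (-(x * Real.cosh t)) * Real.cosh (a * t)) := by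
  have h := ((integrable_exp_mul_exp_neg_cosh a hx).add
    (integrable_exp_mul_exp_neg_cosh (-a) hx)).div_const 2
  refine h.congr (ae_of_all _ fun t => ?_)
  simp only [Pi.add_apply, Real.cosh_eq (a * t)]
  ring_nf

/-- The two-sided form of the Bessel integral is the one that tolerates translations of `t`, on
which the density computation rests. -/
lemma integral_exp_mul_exp_neg_cosh (a : ℝ) {x : ℝ} (hx : 0 < x) :
    ∫ t : ℝ, Real.exp (a * t) * Real.exp (-(x * Real.cosh t)) = 2 * besselK a x := by
  have h1 : ∫ t : ℝ, Real.exp (-a * t) * Real.exp (-(x * Real.cosh t)) =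
      ∫ t : ℝ, Real.exp (a * t) * Real.exp (-(x * Real.cosh t)) := by
    rw [← integral_neg_eq_self]
    simp
  have h2 : 2 * ∫ t : ℝ, Real.exp (-(x * Real.cosh t)) * Real.cosh (a * t) =
      (∫ t : ℝ, Real.exp (a * t) * Real.exp (-(x * Real.cosh t))) +
      ∫ t : ℝ, Real.exp (-a * t) * Real.exp (-(x * Real.cosh t)) := by
    rw [← integral_add (integrable_exp_mul_exp_neg_cosh a hx)
      (integrable_exp_mul_exp_neg_cosh (-a) hx), ← integral_const_mul]
    congr 1 with t
    simp only [Real.cosh_eq (a * t)]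
    ring_nf
  have h3 := integral_comp_abs (f := fun t => Real.exp (-(x * Real.cosh t)) * Real.cosh (a * t))
  have h4 : (fun t : ℝ => Real.exp (-(x * Real.cosh |t|)) * Real.cosh (a * |t|)) =
      fun t => Real.exp (-(x * Real.cosh t)) * Real.cosh (a * t) := by
    ext t
    rcases abs_choice t with h | h <;> simp [h]
  rw [h4] at h3
  rw [besselK]
  linarith

lemma besselK_nonneg (a x : ℝ) : 0 ≤ besselK a x :=
  integral_nonneg fun _ => mul_nonneg (Real.exp_pos _).le (Real.cosh_pos _).le

lemma besselK_mono {a b x : ℝ} (hab : |a| ≤ |b|) (hx : 0 < x) : besselK a x ≤ besselK b x := by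
  refine integral_mono (integrable_exp_neg_cosh_mul_cosh a hx).integrableOn
    (integrable_exp_neg_cosh_mul_cosh b hx).integrableOn fun t => ?_
  refine mul_le_mul_of_nonneg_left ?_ (Real.exp_pos _).le
  rw [Real.cosh_le_cosh, abs_mul, abs_mul]
  exact mul_le_mul_of_nonneg_right hab (abs_nonneg t)

lemma besselK_le {a x : ℝ} (ha : 0 < a) (hx : 0 < x) :
    besselK a x ≤ (2 / x) ^ a * Real.Gamma a := by
  have h := integral_mono (integrable_exp_mul_exp_neg_cosh a hx)
    (integrable_exp_mul_exp_neg_exp ha (half_pos hx)) fun t =>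
      mul_le_mul_of_nonneg_left (exp_neg_mul_cosh_le hx t) (Real.exp_pos _).le
  rw [integral_exp_mul_exp_neg_cosh a hx, integral_exp_mul_exp_neg_exp ha (half_pos hx),
    one_div_div] at h
  linarith [besselK_nonneg a x]

/-- `exp (-x cosh t) sinh (a t)` vanishes at `0` and at infinity, so its derivative integrates to
`0`; product formulas for hyperbolic functions turn this into the recurrence. -/
lemma besselK_add_one_sub (a : ℝ) {x : ℝ} (hx : 0 < x) :
    x * (besselK (a + 1) x - besselK (a - 1) x) = 2 * a * besselK a x := by
  have hi := fun b : ℝ => (integrable_exp_neg_cosh_mul_cosh b hx).integrableOn (s := Set.Ioi 0)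
  set u : ℝ → ℝ := fun t => Real.exp (-(x * Real.cosh t)) * Real.sinh (a * t) with hu
  set u' : ℝ → ℝ := fun t => a * (Real.exp (-(x * Real.cosh t)) * Real.cosh (a * t)) -
    x / 2 * (Real.exp (-(x * Real.cosh t)) * Real.cosh ((a + 1) * t) -
      Real.exp (-(x * Real.cosh t)) * Real.cosh ((a - 1) * t)) with hu'
  have hd : ∀ t, HasDerivAt u (u' t) t := by
    intro t
    have h1 : HasDerivAt (fun t => Real.exp (-(x * Real.cosh t)))
        (Real.exp (-(x * Real.cosh t)) * (-(x * Real.sinh t))) t :=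
      (((Real.hasDerivAt_cosh t).const_mul x).neg).exp
    have h2 : HasDerivAt (fun t => Real.sinh (a * t)) (Real.cosh (a * t) * (a * 1)) t :=
      ((hasDerivAt_id t).const_mul a).sinh
    convert! h1.mul h2 using 1
    simp only [hu', add_mul, sub_mul, one_mul, Real.cosh_add, Real.cosh_sub]
    ring
  have hu'i : IntegrableOn u' (Set.Ioi 0) :=
    ((hi a).const_mul a).sub (((hi (a + 1)).sub (hi (a - 1))).const_mul (x / 2))
  have hui : IntegrableOn u (Set.Ioi 0) := by
    refine (hi a).mono' (by fun_prop) (ae_of_all _ fun t => ?_)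
    rw [Real.norm_eq_abs, abs_mul, abs_of_pos (Real.exp_pos _)]
    refine mul_le_mul_of_nonneg_left ?_ (Real.exp_pos _).le
    rw [abs_le, Real.cosh_eq, Real.sinh_eq]
    constructor <;> linarith [Real.exp_pos (a * t), Real.exp_pos (-(a * t))]
  have ht := tendsto_zero_of_hasDerivAt_of_integrableOn_Ioi (fun t _ => hd t) hu'i hui
  have hint := integral_Ioi_of_hasDerivAt_of_tendsto (hd 0).continuousAt.continuousWithinAt
    (fun t _ => hd t) hu'i ht
  have hint2 : ∫ t in Set.Ioi 0, u' t =
      a * besselK a x - x / 2 * (besselK (a + 1) x - besselK (a - 1) x) := by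
    have h1 := integral_sub ((hi a).const_mul a)
      (((hi (a + 1)).sub (hi (a - 1))).const_mul (x / 2))
    have h2 := integral_sub (hi (a + 1)) (hi (a - 1))
    simp only [Pi.sub_apply, integral_const_mul] at h1
    rw [h2] at h1
    exact h1
  have hu0 : u 0 = 0 := by simp [hu]
  rw [hint2, hu0] at hint
  linarith

/-- Differentiation under the integral sign, dominated by the integrand at `x / 2`; the extra factor
`cosh t` splits as `cosh t cosh (a t) = (cosh ((a + 1) t) + cosh ((a - 1) t)) / 2`. -/
lemma hasDerivAt_besselK_aux (a : ℝ) {x : ℝ} (hx : 0 < x) :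
    HasDerivAt (besselK a) (-(besselK (a + 1) x + besselK (a - 1) x) / 2) x := by
  have hi := fun b : ℝ => (integrable_exp_neg_cosh_mul_cosh b hx).integrableOn (s := Set.Ioi 0)
  have hi2 := fun b : ℝ =>
    (integrable_exp_neg_cosh_mul_cosh b (half_pos hx)).integrableOn (s := Set.Ioi 0)
  have hid : ∀ y t : ℝ, Real.exp (-(y * Real.cosh t)) * Real.cosh (a * t) * Real.cosh t =
      (Real.exp (-(y * Real.cosh t)) * Real.cosh ((a + 1) * t) +
      Real.exp (-(y * Real.cosh t)) * Real.cosh ((a - 1) * t)) / 2 := by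
    intro y t
    simp only [add_mul, sub_mul, one_mul, Real.cosh_add, Real.cosh_sub]
    ring
  have h := (hasDerivAt_integral_of_dominated_loc_of_deriv_le
    (μ := volume.restrict (Set.Ioi (0 : ℝ)))
    (F := fun y t => Real.exp (-(y * Real.cosh t)) * Real.cosh (a * t))
    (F' := fun y t => -(Real.exp (-(y * Real.cosh t)) * Real.cosh (a * t) * Real.cosh t))
    (bound := fun t => Real.exp (-(x / 2 * Real.cosh t)) * Real.cosh (a * t) * Real.cosh t)
    (x₀ := x) (s := Set.Ioi (x / 2)) (Ioi_mem_nhds (by linarith))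
    (Eventually.of_forall fun y => by fun_prop) (hi a) (by fun_prop)
    (ae_of_all _ fun t y hy => ?_) ?_ (ae_of_all _ fun t y hy => ?_)).2
  · unfold besselK
    convert! h using 1
    rw [integral_neg]
    simp_rw [hid]
    rw [integral_div, integral_add (hi _) (hi _)]
    ring
  · rw [norm_neg, Real.norm_of_nonneg]
    · have hc := Real.cosh_pos t
      have hca := Real.cosh_pos (a * t)
      have : Real.exp (-(y * Real.cosh t)) ≤ Real.exp (-(x / 2 * Real.cosh t)) :=
        Real.exp_le_exp.2 (by nlinarith [hy.out])
      gcongr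
    · have hc := Real.cosh_pos t
      have hca := Real.cosh_pos (a * t)
      positivity
  · simp_rw [hid]
    exact ((hi2 _).add (hi2 _)).div_const 2
  · have h1 : HasDerivAt (fun y => Real.exp (-(y * Real.cosh t)))
        (Real.exp (-(y * Real.cosh t)) * (-(1 * Real.cosh t))) y :=
      (((hasDerivAt_id y).mul_const _).neg).exp
    convert! h1.mul_const (Real.cosh (a * t)) using 1
    ring

/-- The recurrence eliminates one of the two neighbouring orders. Both variants are needed, so that
`K_a` and `K_(a-1)` can be differentiated without leaving these two orders. -/
lemma hasDerivAt_besselK (a : ℝ) {x : ℝ} (hx : 0 < x) :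
    HasDerivAt (besselK a) (-(a / x) * besselK a x - besselK (a - 1) x) x := by
  convert! hasDerivAt_besselK_aux a hx using 1
  have h := besselK_add_one_sub a hx
  field_simp
  linarith

lemma hasDerivAt_besselK' (a : ℝ) {x : ℝ} (hx : 0 < x) :
    HasDerivAt (besselK a) (a / x * besselK a x - besselK (a + 1) x) x := by
  convert! hasDerivAt_besselK_aux a hx using 1
  have h := besselK_add_one_sub a hx
  field_simp
  linarith

lemma tendsto_rpow_mul_besselK {a b : ℝ} (hb : 0 < b) (hab : |a| < b) :
    Tendsto (fun x => x ^ b * besselK a x) (𝓝[>] 0) (𝓝 0) := by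
  -- The power bound needs a positive order, while `a` may be zero or negative. An order `c`
  -- strictly between `max 0 |a|` and `b` dominates `K_a` and leaves the vanishing factor `x ^ (b -
  -- c)`.
  obtain ⟨c, hc1, hc2⟩ := exists_between (max_lt hb hab)
  have hc0 : 0 < c := (le_max_left _ _).trans_lt hc1
  have hac : |a| ≤ |c| := ((le_max_right _ _).trans hc1.le).trans (le_abs_self c)
  have hlim : Tendsto (fun x : ℝ => x ^ (b - c) * (2 ^ c * Real.Gamma c)) (𝓝[>] 0) (𝓝 0) := by
    have h : Tendsto (fun x : ℝ => x ^ (b - c)) (𝓝[>] 0) (𝓝 0) := by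
      have := (Real.continuousAt_rpow_const 0 (b - c) (Or.inr (by linarith))).tendsto
      rw [Real.zero_rpow (by linarith)] at this
      exact this.mono_left nhdsWithin_le_nhds
    simpa using h.mul_const (2 ^ c * Real.Gamma c)
  refine tendsto_of_tendsto_of_tendsto_of_le_of_le' tendsto_const_nhds hlim ?_ ?_
  · filter_upwards [self_mem_nhdsWithin] with x hx
    exact mul_nonneg (Real.rpow_nonneg (le_of_lt hx) _) (besselK_nonneg _ _)
  · filter_upwards [self_mem_nhdsWithin] with x hx
    have hx : 0 < x := hx
    have h := (besselK_mono hac hx).trans (besselK_le hc0 hx)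
    calc x ^ b * besselK a x ≤ x ^ b * ((2 / x) ^ c * Real.Gamma c) := by gcongr
      _ = _ := by
        rw [Real.div_rpow (by norm_num) hx.le, Real.rpow_sub hx]
        field_simp

end Bessel

/-! ### The modified Struve function: power series and derivatives. -/

section Struve

/-- The coefficients of the power series in the modified Struve function. -/
def struveCoeff (a : ℝ) (n : ℕ) : ℝ :=
  1 / (Real.Gamma (n + 3 / 2) * Real.Gamma (n + a + 3 / 2))

/-- The even entire function with `L_a(x) = (x / 2) ^ (a + 1) * struveSeries a (x / 2)`. -/
def struveSeries (a x : ℝ) : ℝ := ∑' n : ℕ, struveCoeff a n * x ^ (2 * n)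

lemma struveL_eq (a x : ℝ) : struveL a x = (x / 2) ^ (a + 1) * struveSeries a (x / 2) := by
  simp only [struveL, struveSeries, struveCoeff]
  congr 2 with n
  ring

lemma struveCoeff_pos {a : ℝ} (ha : -1 ≤ a) (n : ℕ) : 0 < struveCoeff a n := by
  have hn : (0 : ℝ) ≤ n := n.cast_nonneg
  have h1 := Real.Gamma_pos_of_pos (s := n + 3 / 2) (by linarith)
  have h2 := Real.Gamma_pos_of_pos (s := n + a + 3 / 2) (by linarith)
  rw [struveCoeff]
  positivity

lemma struveCoeff_succ {a : ℝ} (ha : -1 ≤ a) (n : ℕ) :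
    struveCoeff a (n + 1) * ((n + 3 / 2) * (n + a + 3 / 2)) = struveCoeff a n := by
  have hn : (0 : ℝ) ≤ n := n.cast_nonneg
  have h1 := Real.Gamma_pos_of_pos (s := n + 3 / 2) (by linarith)
  have h2 := Real.Gamma_pos_of_pos (s := n + a + 3 / 2) (by linarith)
  have e1 := Real.Gamma_add_one (s := n + 3 / 2) (by linarith)
  have e2 := Real.Gamma_add_one (s := n + a + 3 / 2) (by linarith)
  have h3 : (n : ℝ) + 3 / 2 ≠ 0 := by linarith
  have h4 : (n : ℝ) + a + 3 / 2 ≠ 0 := by linarith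
  rw [struveCoeff, struveCoeff]
  push_cast
  rw [show (n : ℝ) + 1 + 3 / 2 = n + 3 / 2 + 1 by ring,
    show (n : ℝ) + 1 + a + 3 / 2 = n + a + 3 / 2 + 1 by ring, e1, e2]
  generalize Real.Gamma (n + 3 / 2) = g at *
  generalize Real.Gamma (n + a + 3 / 2) = g' at *
  generalize (n : ℝ) + 3 / 2 = p at *
  generalize (n : ℝ) + a + 3 / 2 = p' at *
  field_simp

/-- For `a ≥ -1` the ratio of consecutive coefficients is at most `2 / (n + 1)`, so the series is
dominated by an exponential series. The bound `-1` is the value of `(r - 3) / 2` at `r = 1`. -/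
lemma struveCoeff_le {a : ℝ} (ha : -1 ≤ a) (n : ℕ) :
    struveCoeff a n ≤ struveCoeff a 0 * (2 ^ n / n.factorial) := by
  induction n with
  | zero => simp
  | succ n ih =>
    have hn : (0 : ℝ) ≤ n := n.cast_nonneg
    have hp := struveCoeff_pos ha (n + 1)
    have h1 : ((n : ℝ) + 1) * (1 / 2) ≤ (n + 3 / 2) * (n + a + 3 / 2) := by
      gcongr <;> linarith
    have h2 : struveCoeff a (n + 1) * (((n : ℝ) + 1) * (1 / 2)) ≤
        struveCoeff a 0 * (2 ^ n / n.factorial) := by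
      refine le_trans ?_ ih
      rw [← struveCoeff_succ ha n]
      gcongr
    calc struveCoeff a (n + 1)
        = struveCoeff a (n + 1) * (((n : ℝ) + 1) * (1 / 2)) * (2 / (n + 1)) := by
          field_simp
      _ ≤ struveCoeff a 0 * (2 ^ n / n.factorial) * (2 / (n + 1)) := by gcongr
      _ = _ := by
          rw [Nat.factorial_succ]
          push_cast
          field_simp
          ring

lemma struveCoeff_nat_mul_le {a : ℝ} (ha : -1 ≤ a) (n : ℕ) :
    n * struveCoeff a n ≤ struveCoeff a 0 * (4 ^ n / n.factorial) := by
  have h0 := struveCoeff_pos ha 0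
  have hn : (n : ℝ) ≤ 2 ^ n := by exact_mod_cast Nat.lt_two_pow_self.le
  calc n * struveCoeff a n ≤ 2 ^ n * (struveCoeff a 0 * (2 ^ n / n.factorial)) :=
        mul_le_mul hn (struveCoeff_le ha n) (struveCoeff_pos ha n).le (by positivity)
    _ = _ := by
        rw [show (4 : ℝ) = 2 * 2 by norm_num, mul_pow]
        ring

lemma summable_struve_nat_mul {a : ℝ} (ha : -1 ≤ a) (x : ℝ) :
    Summable fun n : ℕ => n * struveCoeff a n * x ^ (2 * n) := by
  refine Summable.of_nonneg_of_le (fun n => ?_) (fun n => ?_)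
    ((Real.summable_pow_div_factorial (4 * x ^ 2)).mul_left (struveCoeff a 0))
  · have := struveCoeff_pos ha n
    rw [pow_mul]
    positivity
  · calc n * struveCoeff a n * x ^ (2 * n)
        ≤ struveCoeff a 0 * (4 ^ n / n.factorial) * x ^ (2 * n) := by
          have := struveCoeff_nat_mul_le ha n
          have : 0 ≤ x ^ (2 * n) := by rw [pow_mul]; positivity
          gcongr
      _ = _ := by
          rw [mul_pow, pow_mul]
          ring

lemma summable_struve {a : ℝ} (ha : -1 ≤ a) (x : ℝ) :
    Summable fun n : ℕ => struveCoeff a n * x ^ (2 * n) := by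
  refine Summable.of_nonneg_of_le (fun n => ?_) (fun n => ?_)
    ((Real.summable_pow_div_factorial (2 * x ^ 2)).mul_left (struveCoeff a 0))
  · have := struveCoeff_pos ha n
    rw [pow_mul]
    positivity
  · calc struveCoeff a n * x ^ (2 * n)
        ≤ struveCoeff a 0 * (2 ^ n / n.factorial) * x ^ (2 * n) := by
          have := struveCoeff_le ha n
          have : 0 ≤ x ^ (2 * n) := by rw [pow_mul]; positivity
          gcongr
      _ = _ := by
          rw [mul_pow, pow_mul]
          ring

/-- The derivative of `struveSeries a` times the argument. -/
def struveEuler (a x : ℝ) : ℝ := ∑' n : ℕ, 2 * (n * struveCoeff a n * x ^ (2 * n))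

lemma hasDerivAt_struveSeries {a : ℝ} (ha : -1 ≤ a) {x : ℝ} (hx : 0 < x) :
    HasDerivAt (struveSeries a) (struveEuler a x / x) x := by
  set R : ℝ := 2 * x
  have hterm : ∀ (n : ℕ) (y : ℝ), 0 < y →
      HasDerivAt (fun y => struveCoeff a n * y ^ (2 * n))
        (2 * (n * struveCoeff a n * y ^ (2 * n)) / y) y := by
    intro n y hy
    convert! (hasDerivAt_pow (2 * n) y).const_mul (struveCoeff a n) using 1
    rcases n with _ | n
    · simp
    · rw [show 2 * (n + 1) - 1 = 2 * n + 1 by omega, show 2 * (n + 1) = 2 * n + 1 + 1 by ring,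
        pow_succ]
      field_simp
      push_cast
      ring
  have h := hasDerivAt_tsum_of_isPreconnected
    (u := fun n : ℕ => n * struveCoeff a n * R ^ (2 * n) * (4 / x))
    (g := fun (n : ℕ) y => struveCoeff a n * y ^ (2 * n))
    (g' := fun (n : ℕ) y => 2 * (n * struveCoeff a n * y ^ (2 * n)) / y)
    -- Staying above `x / 2` controls the factor `1 / y` in the termwise derivative, and staying
    -- below `R = 2x` controls the powers.
    (t := Set.Ioo (x / 2) R) (y₀ := x) (y := x)
    ((summable_struve_nat_mul ha R).mul_right _) isOpen_Ioo isPreconnected_Ioo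
    (fun n y hy => hterm n y (by linarith [hy.1])) (fun n y hy => ?_)
    ⟨by linarith, by simp only [R]; linarith⟩ (summable_struve ha x)
    ⟨by linarith, by simp only [R]; linarith⟩
  · convert! h using 1
    rw [struveEuler, tsum_div_const]
  · have hy0 : 0 < y := by linarith [hy.1]
    have hc := struveCoeff_pos ha n
    rw [Real.norm_of_nonneg (by positivity), div_eq_mul_inv]
    have h1 : y ^ (2 * n) ≤ R ^ (2 * n) := pow_le_pow_left₀ hy0.le hy.2.le _
    have h2 : y⁻¹ ≤ 2 / x := by
      rw [inv_le_comm₀ hy0 (by positivity), inv_div]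
      exact hy.1.le
    calc 2 * (n * struveCoeff a n * y ^ (2 * n)) * y⁻¹
        ≤ 2 * (n * struveCoeff a n * R ^ (2 * n)) * (2 / x) := by gcongr
      _ = _ := by ring

lemma continuous_struveSeries {a : ℝ} (ha : -1 ≤ a) : Continuous (struveSeries a) := by
  refine continuous_iff_continuousAt.2 fun x => ?_
  have hR : x ∈ Set.Ioo (-(|x| + 1)) (|x| + 1) := by
    constructor <;> linarith [neg_abs_le x, le_abs_self x]
  refine (continuousOn_tsum (u := fun n : ℕ => struveCoeff a n * (|x| + 1) ^ (2 * n))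
    (fun n => by fun_prop) (summable_struve ha _) fun n y hy => ?_).continuousAt
      (Ioo_mem_nhds hR.1 hR.2)
  have hc := struveCoeff_pos ha n
  rw [norm_mul, norm_pow, Real.norm_of_nonneg hc.le, Real.norm_eq_abs]
  have : |y| ≤ |x| + 1 := (abs_lt.2 hy).le
  gcongr

lemma struveCoeff_sub_one {a : ℝ} (ha : 0 ≤ a) (n : ℕ) :
    struveCoeff (a - 1) n = (n + a + 1 / 2) * struveCoeff a n := by
  have hn : (0 : ℝ) ≤ n := n.cast_nonneg
  have e := Real.Gamma_add_one (s := n + a + 1 / 2) (by linarith)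
  have h1 := Real.Gamma_pos_of_pos (s := n + 3 / 2) (by linarith)
  have h2 := Real.Gamma_pos_of_pos (s := n + a + 1 / 2) (by linarith)
  have h3 : (n : ℝ) + a + 1 / 2 ≠ 0 := by linarith
  rw [struveCoeff, struveCoeff, show (n : ℝ) + (a - 1) + 3 / 2 = n + a + 1 / 2 by ring,
    show (n : ℝ) + a + 3 / 2 = n + a + 1 / 2 + 1 by ring, e]
  field_simp

/-- The functional equation of the second Gamma factor lowers the order, without shifting the index.
-/
lemma struveEuler_add_mul {a : ℝ} (ha : 0 ≤ a) (x : ℝ) :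
    struveEuler a x + (2 * a + 1) * struveSeries a x = 2 * struveSeries (a - 1) x := by
  rw [struveEuler, struveSeries, struveSeries, ← tsum_mul_left, ← tsum_mul_left,
    ← ((summable_struve_nat_mul (by linarith) x).mul_left 2).tsum_add
      ((summable_struve (by linarith) x).mul_left _)]
  congr 1 with n
  rw [struveCoeff_sub_one ha]
  ring

lemma struveCoeff_add_one {a : ℝ} (n : ℕ) :
    struveCoeff (a + 1) n = (n + 3 / 2) * struveCoeff a (n + 1) := by
  have hn : (0 : ℝ) ≤ n := n.cast_nonneg
  have e := Real.Gamma_add_one (s := n + 3 / 2) (by linarith)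
  have h1 := Real.Gamma_pos_of_pos (s := n + 3 / 2) (by linarith)
  have h3 : (n : ℝ) + 3 / 2 ≠ 0 := by linarith
  rw [struveCoeff, struveCoeff]
  push_cast
  rw [show (n : ℝ) + 1 + 3 / 2 = n + 3 / 2 + 1 by ring,
    show (n : ℝ) + 1 + a + 3 / 2 = n + (a + 1) + 3 / 2 by ring, e]
  rw [one_div, one_div, mul_inv, mul_inv, mul_inv]
  field_simp

/-- The functional equation of the first Gamma factor raises the order at the price of an index
shift; the term `n = 0` is left over as an inhomogeneity. -/
lemma struveEuler_add {a : ℝ} (ha : -1 ≤ a) (x : ℝ) :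
    struveEuler a x + struveSeries a x =
      struveCoeff a 0 + 2 * x ^ 2 * struveSeries (a + 1) x := by
  have hs := ((summable_struve_nat_mul ha x).mul_left 2).add (summable_struve ha x)
  rw [struveEuler, struveSeries, struveSeries, ← tsum_mul_left,
    ← ((summable_struve_nat_mul ha x).mul_left 2).tsum_add (summable_struve ha x),
    hs.tsum_eq_zero_add]
  congr 1
  · simp
  · congr 1 with n
    rw [struveCoeff_add_one, show 2 * (n + 1) = 2 * n + 2 by ring, pow_add]
    push_cast
    ring

lemma hasDerivAt_struveL_aux {a : ℝ} (ha : -1 ≤ a) {x : ℝ} (hx : 0 < x) :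
    HasDerivAt (struveL a) ((x / 2) ^ (a + 1) / x *
      ((a + 1) * struveSeries a (x / 2) + struveEuler a (x / 2))) x := by
  have hx2 : 0 < x / 2 := half_pos hx
  have hd : HasDerivAt (fun y : ℝ => y / 2) (1 / 2) x := (hasDerivAt_id x).div_const 2
  have h1 : HasDerivAt (fun y : ℝ => (y / 2) ^ (a + 1)) _ x :=
    hd.rpow_const (Or.inl hx2.ne')
  have h2 : HasDerivAt (fun y : ℝ => struveSeries a (y / 2)) _ x :=
    HasDerivAt.comp (h := fun y : ℝ => y / 2) x (hasDerivAt_struveSeries ha hx2) hd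
  have he : struveL a = fun y => (y / 2) ^ (a + 1) * struveSeries a (y / 2) :=
    funext (struveL_eq a)
  rw [he]
  convert! h1.mul h2 using 1
  rw [Real.rpow_sub_one hx2.ne']
  field_simp

lemma hasDerivAt_struveL {a : ℝ} (ha : 0 ≤ a) {x : ℝ} (hx : 0 < x) :
    HasDerivAt (struveL a) (struveL (a - 1) x - a / x * struveL a x) x := by
  convert! hasDerivAt_struveL_aux (a := a) (by linarith) hx using 1
  have h := struveEuler_add_mul ha (x / 2)
  rw [struveL_eq, struveL_eq, sub_add_cancel, Real.rpow_add_one (half_pos hx).ne',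
    show struveEuler a (x / 2) =
      2 * struveSeries (a - 1) (x / 2) - (2 * a + 1) * struveSeries a (x / 2) by linarith]
  field_simp
  ring

lemma hasDerivAt_struveL' {a : ℝ} (ha : -1 ≤ a) {x : ℝ} (hx : 0 < x) :
    HasDerivAt (struveL a) (struveL (a + 1) x + a / x * struveL a x +
      (x / 2) ^ a / (√Real.pi * Real.Gamma (a + 3 / 2))) x := by
  convert! hasDerivAt_struveL_aux ha hx using 1
  have h := struveEuler_add ha (x / 2)
  have hx2 := (half_pos hx).ne'
  have hg : Real.Gamma (3 / 2) = √Real.pi / 2 := by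
    rw [show (3 : ℝ) / 2 = 1 / 2 + 1 by norm_num, Real.Gamma_add_one (by norm_num),
      Real.Gamma_one_half_eq]
    ring
  have hc : struveCoeff a 0 = 2 / (√Real.pi * Real.Gamma (a + 3 / 2)) := by
    have := Real.Gamma_pos_of_pos (s := a + 3 / 2) (by linarith)
    have : 0 < √Real.pi := Real.sqrt_pos.2 Real.pi_pos
    rw [struveCoeff]
    simp only [Nat.cast_zero, zero_add, hg]
    field_simp
  have hc' : (x / 2) ^ a / (√Real.pi * Real.Gamma (a + 3 / 2)) =
      (x / 2) ^ a * struveCoeff a 0 / 2 := by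
    rw [hc]; ring
  rw [hc', struveL_eq, struveL_eq, Real.rpow_add_one hx2, Real.rpow_add_one hx2,
    show struveEuler a (x / 2) = struveCoeff a 0 + 2 * (x / 2) ^ 2 * struveSeries (a + 1) (x / 2) -
      struveSeries a (x / 2) by linarith]
  field_simp
  ring

end Struve

/-! ### The function `V` as an antiderivative. -/

section CDF

lemma equalCorrV_eq (r : ℕ) {ρ : ℝ} (hρ : ρ ≠ 0) (z : ℝ) :
    equalCorrV r ρ z = equalCorrV r 1 (z / ρ) := by
  simp only [equalCorrV, div_one]
  field_simp

/-- With `a = (r - 1) / 2`, each factor is differentiated by the formula that stays in the orders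
`a` and `a - 1`. The products `K_a L_a` and `K_(a-1) L_(a-1)` cancel, the `1 / w` terms cancel the
derivative of the prefactor, and only the inhomogeneous term of `L_(a-1)'`, multiplied by `K_a`,
survives. -/
lemma hasDerivAt_equalCorrV_one {r : ℕ} (hr : 1 ≤ r) {w : ℝ} (hw : 0 < w) :
    HasDerivAt (equalCorrV r 1) (1 / (√Real.pi * Real.Gamma ((r : ℝ) / 2)) *
      besselK (((r : ℝ) - 1) / 2) w * (w / 2) ^ (((r : ℝ) - 1) / 2)) w := by
  have hr' : (1 : ℝ) ≤ r := by exact_mod_cast hr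
  obtain ⟨a, ha⟩ : ∃ a : ℝ, a = ((r : ℝ) - 1) / 2 := ⟨_, rfl⟩
  have ha0 : 0 ≤ a := by rw [ha]; linarith
  have e1 : ((r : ℝ) - 3) / 2 = a - 1 := by rw [ha]; ring
  have e2 : (r : ℝ) / 2 = a - 1 + 3 / 2 := by rw [ha]; ring
  have hfun : equalCorrV r 1 = fun w => w / 2 * (besselK a w * struveL (a - 1) w +
      besselK (a - 1) w * struveL a w) := by
    ext w
    simp only [equalCorrV, div_one, mul_one, e1, ← ha]
  have hk1 := hasDerivAt_besselK a hw
  have hk2 := hasDerivAt_besselK' (a - 1) hw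
  have hl1 := hasDerivAt_struveL ha0 hw
  have hl2 := hasDerivAt_struveL' (a := a - 1) (by linarith) hw
  rw [sub_add_cancel] at hk2 hl2
  rw [hfun, ← ha, e2]
  have hG := Real.Gamma_pos_of_pos (s := a - 1 + 3 / 2) (by linarith)
  have hpi : 0 < √Real.pi := Real.sqrt_pos.2 Real.pi_pos
  convert! ((hasDerivAt_id w).div_const 2).mul ((hk1.mul hl2).add (hk2.mul hl1)) using 1
  simp only [id_eq, Pi.add_apply, Pi.mul_apply]
  rw [Real.rpow_sub_one (half_pos hw).ne']
  field_simp
  ring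

/-- The prefactor and the leading powers of `L` contribute `w ^ (a + 1)` against `K_a` and `w ^ (a +
2)` against `K_(a-1)`. These exponents exceed the absolute orders for every `a ≥ 0`; the remaining
Struve series are continuous at `0`. -/
lemma tendsto_equalCorrV_one {r : ℕ} (hr : 1 ≤ r) :
    Tendsto (equalCorrV r 1) (𝓝[>] 0) (𝓝 0) := by
  have hr' : (1 : ℝ) ≤ r := by exact_mod_cast hr
  obtain ⟨a, ha⟩ : ∃ a : ℝ, a = ((r : ℝ) - 1) / 2 := ⟨_, rfl⟩
  have ha0 : 0 ≤ a := by rw [ha]; linarith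
  have e1 : ((r : ℝ) - 3) / 2 = a - 1 := by rw [ha]; ring
  have hs : ∀ b : ℝ, -1 ≤ b → Tendsto (fun w : ℝ => struveSeries b (w / 2)) (𝓝[>] 0)
      (𝓝 (struveSeries b (0 / 2))) := fun b hb =>
    (((continuous_struveSeries hb).comp (continuous_id.div_const 2)).tendsto 0).mono_left
      nhdsWithin_le_nhds
  have h1 := ((tendsto_rpow_mul_besselK (a := a) (b := a + 1) (by linarith)
    (by rw [abs_of_nonneg ha0]; linarith)).mul (hs (a - 1) (by linarith))).const_mul
      ((1 / 2 : ℝ) ^ (a + 1))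
  have h2 := ((tendsto_rpow_mul_besselK (a := a - 1) (b := a + 2) (by linarith)
    (by rw [abs_lt]; constructor <;> linarith)).mul (hs a (by linarith))).const_mul
      ((1 / 2 : ℝ) ^ (a + 2))
  have h := h1.add h2
  simp only [zero_mul, mul_zero, add_zero] at h
  refine h.congr' ?_
  filter_upwards [self_mem_nhdsWithin] with w hw
  have hw : 0 < w := hw
  simp only [equalCorrV, div_one, mul_one, e1, ← ha]
  have hp : ∀ b : ℝ, (1 / 2 : ℝ) ^ b * w ^ b = (w / 2) ^ b := fun b => by
    rw [← Real.mul_rpow (by norm_num) hw.le]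
    ring_nf
  rw [struveL_eq, struveL_eq, sub_add_cancel, mul_add]
  congr 1
  · rw [← mul_assoc, ← mul_assoc, hp, Real.rpow_add_one (half_pos hw).ne']
    ring
  · rw [← mul_assoc, ← mul_assoc, hp, show a + 2 = a + 1 + 1 by ring,
      Real.rpow_add_one (half_pos hw).ne']
    ring

end CDF

/-! ### A Bessel integral that extends to argument zero. -/

section BesselIntegral

/-- Translating `t` by `log y` symmetrizes `exp t + y² exp (-t)` into `2 y cosh`. -/
lemma exp_mul_exp_neg_shift (a : ℝ) {y : ℝ} (hy : 0 < y) (t : ℝ) :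
    Real.exp (a * t) * Real.exp (-((Real.exp t + y ^ 2 * Real.exp (-t)) / 2)) =
      y ^ a * (Real.exp (a * (t - Real.log y)) *
        Real.exp (-(y * Real.cosh (t - Real.log y)))) := by
  have h1 : y ^ a * Real.exp (a * (t - Real.log y)) = Real.exp (a * t) := by
    rw [Real.rpow_def_of_pos hy, ← Real.exp_add]
    ring_nf
  have h2 : y * Real.cosh (t - Real.log y) = (Real.exp t + y ^ 2 * Real.exp (-t)) / 2 := by
    rw [Real.cosh_eq, neg_sub, Real.exp_sub, Real.exp_sub, Real.exp_log hy, Real.exp_neg]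
    field_simp
  rw [← mul_assoc, h1, h2]

lemma integrable_exp_mul_exp_neg_add (a : ℝ) {y : ℝ} (hy : 0 < y) :
    Integrable (fun t : ℝ =>
      Real.exp (a * t) * Real.exp (-((Real.exp t + y ^ 2 * Real.exp (-t)) / 2))) := by
  simp_rw [exp_mul_exp_neg_shift a hy]
  exact ((integrable_exp_mul_exp_neg_cosh a hy).comp_sub_right (Real.log y)).const_mul (y ^ a)

lemma integral_exp_mul_exp_neg_add (a : ℝ) {y : ℝ} (hy : 0 < y) :
    ∫ t : ℝ, Real.exp (a * t) * Real.exp (-((Real.exp t + y ^ 2 * Real.exp (-t)) / 2)) =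
      2 * (y ^ a * besselK a y) := by
  simp_rw [exp_mul_exp_neg_shift a hy]
  rw [integral_const_mul, integral_sub_right_eq_self
    (fun t => Real.exp (a * t) * Real.exp (-(y * Real.cosh t))), integral_exp_mul_exp_neg_cosh a hy]
  ring

/-- In the translated integral one may put `y = 0`, with domination by the integrand there, and a
gamma integral remains. This limit supplies the value of the density at its centre. -/
lemma tendsto_rpow_mul_besselK_same {a : ℝ} (ha : 0 < a) :
    Tendsto (fun y => y ^ a * besselK a y) (𝓝[>] 0) (𝓝 (2 ^ a * Real.Gamma a / 2)) := by
  have h := (continuousAt_of_dominated (x₀ := (0 : ℝ))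
    (F := fun y t => Real.exp (a * t) * Real.exp (-((Real.exp t + y ^ 2 * Real.exp (-t)) / 2)))
    (bound := fun t => Real.exp (a * t) * Real.exp (-(1 / 2 * Real.exp t)))
    (Eventually.of_forall fun y => by fun_prop)
    (Eventually.of_forall fun y => ae_of_all _ fun t => ?_)
    (integrable_exp_mul_exp_neg_exp ha one_half_pos)
    (ae_of_all _ fun t => by fun_prop)).tendsto.mono_left (nhdsWithin_le_nhds (s := Set.Ioi 0))
  · have e : ∀ t : ℝ, -((Real.exp t + 0 ^ 2 * Real.exp (-t)) / 2) = -(1 / 2 * Real.exp t) :=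
      fun t => by ring
    simp only [e, integral_exp_mul_exp_neg_exp ha one_half_pos, one_div_one_div] at h
    refine (h.div_const 2).congr' ?_
    filter_upwards [self_mem_nhdsWithin] with y hy
    rw [integral_exp_mul_exp_neg_add a hy]
    ring
  · rw [Real.norm_of_nonneg (by positivity)]
    gcongr
    have := Real.exp_pos (-t)
    nlinarith [sq_nonneg y, mul_nonneg (sq_nonneg y) this.le]

end BesselIntegral

/-! ### Integrals against the gamma distribution. -/

section GammaMeasure

/-- Discarding the null point `0` leaves the open half-line, where the rules for real powers apply.
-/
lemma gammaMeasure_eq_restrict (a b : ℝ) :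
    gammaMeasure a b = (volume.restrict (Set.Ioi 0)).withDensity fun x =>
      ENNReal.ofReal (b ^ a / Real.Gamma a * x ^ (a - 1) * Real.exp (-(b * x))) := by
  rw [gammaMeasure, ← withDensity_indicator measurableSet_Ioi]
  refine withDensity_congr_ae ?_
  filter_upwards [compl_mem_ae_iff.2 (measure_singleton (0 : ℝ))] with x hx
  have hx : x ≠ 0 := hx
  rw [gammaPDF_eq, Set.indicator_apply]
  rcases lt_or_gt_of_ne hx with h | h
  · rw [if_neg (not_le.2 h), if_neg (by simpa using h.le), ENNReal.ofReal_zero]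
  · rw [if_pos h.le, if_pos (by simpa using h)]

lemma gammaDensity_nonneg {a b : ℝ} (ha : 0 < a) (hb : 0 < b) {x : ℝ} (hx : 0 < x) :
    0 ≤ b ^ a / Real.Gamma a * x ^ (a - 1) * Real.exp (-(b * x)) := by
  have := Real.Gamma_pos_of_pos ha
  positivity

lemma integral_gammaMeasure {a b : ℝ} (ha : 0 < a) (hb : 0 < b) (f : ℝ → ℝ) :
    ∫ x, f x ∂gammaMeasure a b = ∫ x in Set.Ioi 0,
      b ^ a / Real.Gamma a * x ^ (a - 1) * Real.exp (-(b * x)) * f x := by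
  rw [gammaMeasure_eq_restrict, integral_withDensity_eq_integral_toReal_smul₀
    (by fun_prop) (by simp)]
  refine setIntegral_congr_fun measurableSet_Ioi fun x hx => ?_
  simp only [ENNReal.toReal_ofReal (gammaDensity_nonneg ha hb hx), smul_eq_mul]

lemma integrable_gammaMeasure_iff {a b : ℝ} (ha : 0 < a) (hb : 0 < b) (f : ℝ → ℝ) :
    Integrable f (gammaMeasure a b) ↔ IntegrableOn (fun x =>
      b ^ a / Real.Gamma a * x ^ (a - 1) * Real.exp (-(b * x)) * f x) (Set.Ioi 0) := by
  rw [gammaMeasure_eq_restrict, integrable_withDensity_iff_integrable_smul₀'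
    (by fun_prop) (by simp)]
  refine integrableOn_congr_fun (fun x hx => ?_) measurableSet_Ioi
  simp only [ENNReal.toReal_ofReal (gammaDensity_nonneg ha hb hx), smul_eq_mul]

lemma ae_pos_gammaMeasure (a b : ℝ) : ∀ᵐ x ∂gammaMeasure a b, 0 < x := by
  rw [gammaMeasure_eq_restrict]
  exact (withDensity_absolutelyContinuous _ _).ae_le (ae_restrict_mem measurableSet_Ioi)

lemma integral_exp_gammaMeasure {a b c : ℝ} (ha : 0 < a) (hb : 0 < b) (hc : 0 ≤ c) :
    ∫ x, Real.exp (-(c * x)) ∂gammaMeasure a b = (b / (b + c)) ^ a := by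
  have hG := Real.Gamma_pos_of_pos ha
  rw [integral_gammaMeasure ha hb]
  have h := Real.integral_rpow_mul_exp_neg_mul_Ioi ha (r := b + c) (by linarith)
  have e : ∀ x : ℝ, b ^ a / Real.Gamma a * x ^ (a - 1) * Real.exp (-(b * x)) *
      Real.exp (-(c * x)) = b ^ a / Real.Gamma a *
        (x ^ (a - 1) * Real.exp (-((b + c) * x))) := fun x => by
    rw [add_mul, neg_add, Real.exp_add]
    ring
  simp_rw [e]
  rw [integral_const_mul, h, Real.div_rpow hb.le (by linarith), Real.div_rpow one_pos.le
    (by linarith), Real.one_rpow]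
  field_simp

lemma Gamma_add_nat {a : ℝ} (ha : 0 < a) (k : ℕ) :
    Real.Gamma (a + k) = (∏ j ∈ Finset.Icc 1 k, (a + j - 1)) * Real.Gamma a := by
  induction k with
  | zero => simp
  | succ k ih =>
    have hk : (0 : ℝ) ≤ k := k.cast_nonneg
    rw [Finset.prod_Icc_succ_top (by omega)]
    push_cast
    rw [← add_assoc, Real.Gamma_add_one (by linarith), ih]
    ring

lemma integrable_rpow_gammaMeasure {a b s : ℝ} (ha : 0 < a) (hb : 0 < b) (hs : 0 ≤ s) :
    Integrable (fun x => x ^ s) (gammaMeasure a b) := by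
  rw [integrable_gammaMeasure_iff ha hb]
  refine IntegrableOn.congr_fun ((integrableOn_rpow_mul_exp_neg_mul_Ioi (a := a + s)
    (by linarith) hb).const_mul (b ^ a / Real.Gamma a)) (fun x hx => ?_) measurableSet_Ioi
  have hx : 0 < x := hx
  rw [show a + s - 1 = a - 1 + s by ring, Real.rpow_add hx]
  ring

lemma integral_pow_gammaMeasure {a b : ℝ} (ha : 0 < a) (hb : 0 < b) (k : ℕ) :
    ∫ x, x ^ k ∂gammaMeasure a b = (∏ j ∈ Finset.Icc 1 k, (a + j - 1)) / b ^ k := by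
  have hG := Real.Gamma_pos_of_pos ha
  have hk : (0 : ℝ) ≤ k := k.cast_nonneg
  rw [integral_gammaMeasure ha hb]
  have e : Set.EqOn (fun x : ℝ => b ^ a / Real.Gamma a * x ^ (a - 1) * Real.exp (-(b * x)) *
      x ^ k) (fun x => b ^ a / Real.Gamma a *
        (x ^ (a + k - 1) * Real.exp (-(b * x)))) (Set.Ioi 0) := fun x hx => by
    have hx : 0 < x := hx
    simp only
    rw [show a + k - 1 = a - 1 + k by ring, Real.rpow_add hx, Real.rpow_natCast]
    ring
  rw [setIntegral_congr_fun measurableSet_Ioi e, integral_const_mul,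
    Real.integral_rpow_mul_exp_neg_mul_Ioi (by linarith) hb, Gamma_add_nat ha,
    Real.div_rpow one_pos.le hb.le, Real.one_rpow, Real.rpow_add hb, Real.rpow_natCast]
  have := Real.rpow_pos_of_pos hb a
  field_simp

end GammaMeasure

/-! ### The variance-gamma law: characteristic function, density, moments. -/

section VarianceGamma

/-- The law of `ρ √G N`, where `G` has the gamma distribution with shape `a` and rate `1 / 2`, and
`N` is standard normal and independent of `G`. -/
def varGamma (a ρ : ℝ) : Measure ℝ :=
  ((gammaMeasure a (1 / 2)).prod (gaussianReal 0 1)).map fun z => ρ * √z.1 * z.2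

lemma isProbabilityMeasure_varGamma {a : ℝ} (ha : 0 < a) (ρ : ℝ) :
    IsProbabilityMeasure (varGamma a ρ) := by
  have := isProbabilityMeasure_gammaMeasure ha (r := 1 / 2) one_half_pos
  exact Measure.isProbabilityMeasure_map (by fun_prop)

/-- Given `G = g`, the Gaussian characteristic function is `exp (-ρ²s²g/2)`; averaging over `g` is
the Laplace transform of the gamma law. -/
lemma charFun_varGamma {a : ℝ} (ha : 0 < a) (ρ s : ℝ) :
    charFun (varGamma a ρ) s = ((1 / (1 + ρ ^ 2 * s ^ 2)) ^ a : ℝ) := by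
  have := isProbabilityMeasure_gammaMeasure ha (r := 1 / 2) one_half_pos
  rw [charFun_apply_real, varGamma, integral_map (by fun_prop) (by fun_prop), integral_prod]
  · have h1 : ∀ᵐ g ∂gammaMeasure a (1 / 2),
        ∫ n : ℝ, Complex.exp (s * ((ρ * √g * n : ℝ) : ℂ) * Complex.I) ∂gaussianReal 0 1 =
          ((Real.exp (-(ρ ^ 2 * s ^ 2 / 2 * g)) : ℝ) : ℂ) := by
      filter_upwards [ae_pos_gammaMeasure a (1 / 2)] with g hg
      have h := charFun_gaussianReal (μ := 0) (v := 1) (s * (ρ * √g))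
      rw [charFun_apply_real] at h
      push_cast at h ⊢
      simp only [← mul_assoc, mul_zero, zero_mul, one_mul, zero_sub] at h ⊢
      rw [h]
      congr 2
      rw [mul_pow, ← Complex.ofReal_pow (√g), Real.sq_sqrt hg.le]
      ring
    rw [integral_congr_ae h1, integral_complex_ofReal,
      integral_exp_gammaMeasure ha one_half_pos (by positivity)]
    congr 2
    field_simp
  · refine Integrable.of_bound (by fun_prop) 1 (ae_of_all _ fun z => ?_)
    rw [← Complex.ofReal_mul, Complex.norm_exp_ofReal_mul_I]

/-- The density of `varGamma a ρ`, with its continuous extension at the origin. -/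
def varGammaPDF (a ρ x : ℝ) : ℝ :=
  if x = 0 then Real.Gamma (a - 1 / 2) / (2 * ρ * √Real.pi * Real.Gamma a) else
    1 / (ρ * √Real.pi * Real.Gamma a) * besselK (a - 1 / 2) |x / ρ| *
      |x / (2 * ρ)| ^ (a - 1 / 2)

lemma varGammaPDF_of_ne_zero (a ρ : ℝ) {x : ℝ} (hx : x ≠ 0) :
    varGammaPDF a ρ x = 1 / (ρ * √Real.pi * Real.Gamma a) * besselK (a - 1 / 2) |x / ρ| *
      |x / (2 * ρ)| ^ (a - 1 / 2) := if_neg hx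

lemma varGammaPDF_nonneg {a ρ : ℝ} (ha : 1 / 2 ≤ a) (hρ : 0 < ρ) (x : ℝ) :
    0 ≤ varGammaPDF a ρ x := by
  have h1 := Real.Gamma_pos_of_pos (s := a) (by linarith)
  have h2 := Real.Gamma_nonneg_of_nonneg (s := a - 1 / 2) (by linarith)
  have h3 := besselK_nonneg (a - 1 / 2) |x / ρ|
  rw [varGammaPDF]
  split_ifs <;> positivity

lemma continuousAt_varGammaPDF {a ρ : ℝ} (hρ : 0 < ρ) {x : ℝ} (hx : x ≠ 0) :
    ContinuousAt (varGammaPDF a ρ) x := by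
  have h1 : ContinuousAt (fun x => 1 / (ρ * √Real.pi * Real.Gamma a) *
      besselK (a - 1 / 2) |x / ρ| * |x / (2 * ρ)| ^ (a - 1 / 2)) x := by
    have hp : 0 < |x / ρ| := abs_pos.2 (by positivity)
    have hp2 : |x / (2 * ρ)| ≠ 0 := (abs_pos.2 (by positivity)).ne'
    have hb : ContinuousAt (fun x => besselK (a - 1 / 2) |x / ρ|) x :=
      ContinuousAt.comp (f := fun x => |x / ρ|) (hasDerivAt_besselK _ hp).continuousAt
        (by fun_prop)
    have hr : ContinuousAt (fun x => |x / (2 * ρ)| ^ (a - 1 / 2)) x :=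
      ContinuousAt.rpow_const (by fun_prop) (Or.inl hp2)
    exact (continuousAt_const.mul hb).mul hr
  refine h1.congr ?_
  filter_upwards [isOpen_ne.mem_nhds hx] with y hy
  rw [varGammaPDF_of_ne_zero a ρ hy]

lemma continuousAt_varGammaPDF_zero {a ρ : ℝ} (ha : 1 / 2 < a) (hρ : 0 < ρ) :
    ContinuousAt (varGammaPDF a ρ) 0 := by
  have hG := Real.Gamma_pos_of_pos (s := a) (by linarith)
  have hpi : 0 < √Real.pi := Real.sqrt_pos.2 Real.pi_pos
  rw [← continuousWithinAt_compl_self]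
  have habs : Tendsto (fun x : ℝ => |x / ρ|) (𝓝[{0}ᶜ] 0) (𝓝[>] 0) := by
    refine tendsto_nhdsWithin_iff.2 ⟨?_, ?_⟩
    · have h : Continuous fun x : ℝ => |x / ρ| := by fun_prop
      have := h.tendsto 0
      simp only [zero_div, abs_zero] at this
      exact this.mono_left nhdsWithin_le_nhds
    · filter_upwards [self_mem_nhdsWithin] with x hx
      have hx : x ≠ 0 := hx
      exact abs_pos.2 (div_ne_zero hx hρ.ne')
  have h := ((tendsto_rpow_mul_besselK_same (a := a - 1 / 2) (by linarith)).comp habs).const_mul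
    (1 / (ρ * √Real.pi * Real.Gamma a) * (1 / 2) ^ (a - 1 / 2))
  have e0 : varGammaPDF a ρ 0 = 1 / (ρ * √Real.pi * Real.Gamma a) * (1 / 2) ^ (a - 1 / 2) *
      (2 ^ (a - 1 / 2) * Real.Gamma (a - 1 / 2) / 2) := by
    have : (1 / 2 : ℝ) ^ (a - 1 / 2) * 2 ^ (a - 1 / 2) = 1 := by
      rw [← Real.mul_rpow (by norm_num) (by norm_num)]
      norm_num
    rw [varGammaPDF, if_pos rfl]
    linear_combination (-(Real.Gamma (a - 1 / 2) / (2 * ρ * √Real.pi * Real.Gamma a))) * this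
  rw [ContinuousWithinAt, e0]
  refine h.congr' ?_
  filter_upwards [self_mem_nhdsWithin] with x hx
  have hx : x ≠ 0 := hx
  rw [varGammaPDF_of_ne_zero a ρ hx, Function.comp, show x / (2 * ρ) = 1 / 2 * (x / ρ) by
    field_simp, abs_mul, abs_of_pos (one_half_pos (α := ℝ)), Real.mul_rpow (by norm_num)
    (abs_nonneg _)]
  ring

lemma measurable_varGammaPDF (a : ℝ) {ρ : ℝ} (hρ : 0 < ρ) : Measurable (varGammaPDF a ρ) :=
  measurable_of_continuousOn_compl_singleton 0 fun _ hx =>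
    (continuousAt_varGammaPDF hρ hx).continuousWithinAt

/-- With `g = exp t`, the gamma weight and the Gaussian exponent combine into `exp t + y² exp (-t)`
with `y = |x / ρ|`. The normalizing factor `exp (-t/2)` of the Gaussian accounts for the shift from
`a` to `a - 1/2` in the Bessel order. -/
lemma lintegral_gaussianPDF_gammaMeasure {a ρ : ℝ} (ha : 0 < a) (hρ : 0 < ρ) {x : ℝ}
    (hx : x ≠ 0) :
    ∫⁻ g, gaussianPDF 0 (ρ ^ 2 * g).toNNReal x ∂gammaMeasure a (1 / 2) =
      ENNReal.ofReal (varGammaPDF a ρ x) := by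
  have hG := Real.Gamma_pos_of_pos ha
  have hpi : 0 < √Real.pi := Real.sqrt_pos.2 Real.pi_pos
  set y : ℝ := |x / ρ| with hy
  have hy0 : 0 < y := abs_pos.2 (by positivity)
  set C : ℝ := (1 / 2) ^ a / Real.Gamma a / (√2 * √Real.pi * ρ) with hC
  have hC0 : 0 ≤ C := by positivity
  have hmeas : Measurable fun g : ℝ => gaussianPDF 0 (ρ ^ 2 * g).toNNReal x :=
    measurable_uncurry_gaussianPDF.comp (f := fun g : ℝ => ((0 : ℝ), (ρ ^ 2 * g).toNNReal, x))
      (by fun_prop)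
  rw [gammaMeasure_eq_restrict, lintegral_withDensity_eq_lintegral_mul _ (by fun_prop) hmeas]
  have himg := lintegral_image_eq_lintegral_abs_deriv_mul (s := Set.univ) (f := Real.exp)
    (f' := Real.exp) MeasurableSet.univ (fun x _ => (Real.hasDerivAt_exp x).hasDerivWithinAt)
    Real.exp_injective.injOn ((fun g : ℝ => ENNReal.ofReal
      ((1 / 2) ^ a / Real.Gamma a * g ^ (a - 1) * Real.exp (-(1 / 2 * g)))) *
      fun g : ℝ => gaussianPDF 0 (ρ ^ 2 * g).toNNReal x)
  rw [Set.image_univ, Real.range_exp, Measure.restrict_univ] at himg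
  rw [himg]
  have hint : ∀ t : ℝ, ENNReal.ofReal |Real.exp t| * ((fun g : ℝ => ENNReal.ofReal
      ((1 / 2) ^ a / Real.Gamma a * g ^ (a - 1) * Real.exp (-(1 / 2 * g)))) *
      fun g : ℝ => gaussianPDF 0 (ρ ^ 2 * g).toNNReal x) (Real.exp t) =
      ENNReal.ofReal (C * (Real.exp ((a - 1 / 2) * t) *
        Real.exp (-((Real.exp t + y ^ 2 * Real.exp (-t)) / 2)))) := by
    intro t
    have ht := Real.exp_pos t
    simp only [Pi.mul_apply, gaussianPDF, gaussianPDFReal]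
    rw [abs_of_pos ht, ← ENNReal.ofReal_mul (by positivity), ← ENNReal.ofReal_mul ht.le]
    congr 1
    rw [Real.coe_toNNReal _ (by positivity)]
    have e1 : √(2 * Real.pi * (ρ ^ 2 * Real.exp t)) =
        √2 * √Real.pi * ρ * Real.exp (1 / 2 * t) := by
      rw [Real.sqrt_mul (by positivity), Real.sqrt_mul (by positivity),
        Real.sqrt_mul (by positivity), Real.sqrt_sq hρ.le,
        show Real.exp t = Real.exp (1 / 2 * t) ^ 2 by rw [← Real.exp_nat_mul]; ring_nf,
        Real.sqrt_sq (Real.exp_pos _).le]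
      ring
    have e2 : -(x - 0) ^ 2 / (2 * (ρ ^ 2 * Real.exp t)) = -(y ^ 2 * Real.exp (-t) / 2) := by
      rw [hy, sq_abs, Real.exp_neg]
      field_simp
      ring
    have e3 : Real.exp ((a - 1 / 2) * t) =
        Real.exp t * Real.exp t ^ (a - 1) * (Real.exp (1 / 2 * t))⁻¹ := by
      rw [← Real.exp_mul, ← Real.exp_neg, ← Real.exp_add, ← Real.exp_add]
      ring_nf
    have e4 : Real.exp (-((Real.exp t + y ^ 2 * Real.exp (-t)) / 2)) =
        Real.exp (-(1 / 2 * Real.exp t)) * Real.exp (-(y ^ 2 * Real.exp (-t) / 2)) := by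
      rw [← Real.exp_add]
      ring_nf
    rw [e1, e2, e3, e4, hC]
    field_simp
  simp_rw [hint]
  rw [← ofReal_integral_eq_lintegral_ofReal
    ((integrable_exp_mul_exp_neg_add _ hy0).const_mul C) (ae_of_all _ fun t => by positivity),
    integral_const_mul, integral_exp_mul_exp_neg_add _ hy0, varGammaPDF_of_ne_zero a ρ hx]
  congr 1
  rw [show x / (2 * ρ) = 1 / 2 * (x / ρ) by field_simp, abs_mul,
    abs_of_pos (one_half_pos (α := ℝ)), Real.mul_rpow (by norm_num) (abs_nonneg _), ← hy, hC,
    Real.rpow_sub (x := 1 / 2) (by norm_num) a, ← Real.sqrt_eq_rpow (1 / 2), Real.sqrt_div (by norm_num),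
    Real.sqrt_one]
  have h2 : √2 * √2 = (2 : ℝ) := Real.mul_self_sqrt (by norm_num)
  have h2' : 0 < √(2 : ℝ) := by positivity
  field_simp
  linear_combination (-besselK ((2 * a - 1) / 2) y) * h2

/-- Given `G = g`, the law is a centered Gaussian of variance `ρ²g`; Tonelli exchanges the mixture
with the integral over the set. -/
lemma varGamma_eq_withDensity {a ρ : ℝ} (ha : 0 < a) (hρ : 0 < ρ) :
    varGamma a ρ = volume.withDensity fun x => ENNReal.ofReal (varGammaPDF a ρ x) := by
  have := isProbabilityMeasure_gammaMeasure ha (r := 1 / 2) one_half_pos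
  ext C hC
  have hm : Measurable fun z : ℝ × ℝ => ρ * √z.1 * z.2 := by fun_prop
  rw [varGamma, Measure.map_apply hm hC, Measure.prod_apply (hm hC), withDensity_apply _ hC]
  have h1 : ∀ᵐ g ∂gammaMeasure a (1 / 2),
      gaussianReal 0 1 (Prod.mk g ⁻¹' ((fun z : ℝ × ℝ => ρ * √z.1 * z.2) ⁻¹' C)) =
        ∫⁻ x in C, gaussianPDF 0 (ρ ^ 2 * g).toNNReal x := by
    filter_upwards [ae_pos_gammaMeasure a (1 / 2)] with g hg
    have hv : (ρ ^ 2 * g).toNNReal ≠ 0 := by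
      rw [Ne, Real.toNNReal_eq_zero, not_le]
      positivity
    rw [← gaussianReal_apply _ hv, ← Set.preimage_comp]
    have := gaussianReal_map_const_mul (μ := 0) (v := 1) (ρ * √g)
    rw [mul_zero, mul_one] at this
    have e : NNReal.mk ((ρ * √g) ^ 2) (sq_nonneg _) = (ρ ^ 2 * g).toNNReal := by
      ext
      rw [Real.coe_toNNReal _ (by positivity), NNReal.coe_mk, mul_pow, Real.sq_sqrt hg.le]
    rw [← e, ← this, Measure.map_apply (by fun_prop) hC]
    rfl
  rw [lintegral_congr_ae h1, lintegral_lintegral_swap]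
  · refine setLIntegral_congr_fun_ae hC ?_
    filter_upwards [compl_mem_ae_iff.2 (measure_singleton (0 : ℝ))] with x hx _
    exact lintegral_gaussianPDF_gammaMeasure ha hρ hx
  · exact (measurable_uncurry_gaussianPDF.comp
      (f := fun z : ℝ × ℝ => ((0 : ℝ), (ρ ^ 2 * z.1).toNNReal, z.2)) (by fun_prop)).aemeasurable

lemma varGamma_map_neg (a ρ : ℝ) : (varGamma a ρ).map (fun x => -x) = varGamma a (-ρ) := by
  rw [varGamma, varGamma, Measure.map_map (by fun_prop) (by fun_prop)]
  congr 1
  ext z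
  simp

/-- The characteristic function depends only on `ρ²`. Combined with `varGamma_map_neg` this is the
symmetry of the law. -/
lemma varGamma_neg {a : ℝ} (ha : 0 < a) (ρ : ℝ) : varGamma a (-ρ) = varGamma a ρ := by
  have := isProbabilityMeasure_varGamma ha ρ
  have := isProbabilityMeasure_varGamma ha (-ρ)
  refine Measure.ext_of_charFun (funext fun s => ?_)
  rw [charFun_varGamma ha, charFun_varGamma ha, neg_sq]

lemma integrable_pow_varGamma {a : ℝ} (ha : 0 < a) (ρ : ℝ) (m : ℕ) :
    Integrable (fun x => x ^ m) (varGamma a ρ) := by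
  have := isProbabilityMeasure_gammaMeasure ha (r := 1 / 2) one_half_pos
  rw [varGamma, integrable_map_measure (by fun_prop) (by fun_prop)]
  have h1 : Integrable (fun g => ρ ^ m * g ^ ((m : ℝ) / 2)) (gammaMeasure a (1 / 2)) :=
    (integrable_rpow_gammaMeasure ha one_half_pos (by positivity)).const_mul _
  have h2 : Integrable (fun g => ρ ^ m * √g ^ m) (gammaMeasure a (1 / 2)) := by
    refine h1.congr ?_
    filter_upwards [ae_pos_gammaMeasure a (1 / 2)] with g hg
    rw [Real.sqrt_eq_rpow, ← Real.rpow_natCast (g ^ (1 / 2 : ℝ)), ← Real.rpow_mul hg.le]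
    ring_nf
  have h3 : Integrable (fun n : ℝ => n ^ m) (gaussianReal 0 1) := by
    rcases Nat.eq_zero_or_pos m with rfl | hm
    · simp
    · have := (memLp_id_gaussianReal (μ := 0) (v := 1) m).integrable_norm_pow'
      refine this.mono' (by fun_prop) (ae_of_all _ fun x => ?_)
      simp
  refine (h2.mul_prod h3).congr (ae_of_all _ fun z => ?_)
  simp only [Function.comp, mul_pow]

lemma integral_pow_gaussianReal (k : ℕ) :
    ∫ x, x ^ (2 * k) ∂gaussianReal 0 1 = 2 ^ k * ∏ j ∈ Finset.Icc 1 k, ((1 / 2 : ℝ) + j - 1) := by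
  have hpi : 0 < √Real.pi := Real.sqrt_pos.2 Real.pi_pos
  rw [integral_gaussianReal_eq_integral_smul one_ne_zero]
  have e : ∀ x : ℝ, gaussianPDFReal 0 1 x • x ^ (2 * k) =
      (√2 * √Real.pi)⁻¹ * (|x| ^ (2 * k : ℝ) * Real.exp (-(1 / 2) * |x| ^ (2 : ℝ))) := by
    intro x
    rw [gaussianPDFReal, smul_eq_mul, show (2 * k : ℝ) = ((2 * k : ℕ) : ℝ) by push_cast; ring,
      Real.rpow_natCast, Real.rpow_two, sq_abs, pow_mul |x|, sq_abs, ← pow_mul,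
      Real.sqrt_mul (by positivity), Real.sqrt_mul (by positivity)]
    simp only [NNReal.coe_one, sub_zero, Real.sqrt_one, mul_one]
    rw [show -x ^ 2 / 2 = -(1 / 2) * x ^ 2 by ring]
    ring
  simp_rw [e]
  rw [integral_const_mul, integral_comp_abs (f := fun x => x ^ (2 * k : ℝ) *
      Real.exp (-(1 / 2) * x ^ (2 : ℝ))),
    integral_rpow_mul_exp_neg_mul_rpow (by norm_num)
      (by have : (0 : ℝ) ≤ k := k.cast_nonneg
          linarith) one_half_pos,
    show ((2 * k + 1 : ℝ)) / 2 = 1 / 2 + k by ring, Gamma_add_nat one_half_pos,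
    Real.Gamma_one_half_eq, show (-(2 * k + 1 : ℝ)) / 2 = -(1 / 2 + k) by ring,
    Real.rpow_neg (by norm_num), Real.rpow_add (by norm_num), Real.rpow_natCast,
    ← Real.sqrt_eq_rpow, Real.sqrt_div (by norm_num), Real.sqrt_one, one_div_pow]
  field_simp

lemma factorial_two_mul_div (k : ℕ) :
    ((2 * k).factorial : ℝ) / k.factorial = 4 ^ k * ∏ j ∈ Finset.Icc 1 k, ((1 / 2 : ℝ) + j - 1) := by
  induction k with
  | zero => simp
  | succ k ih =>
    rw [Finset.prod_Icc_succ_top (by omega), pow_succ,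
      show (4 : ℝ) ^ k * 4 * ((∏ j ∈ Finset.Icc 1 k, ((1 / 2 : ℝ) + j - 1)) *
        (1 / 2 + (k + 1 : ℕ) - 1)) = 4 ^ k * (∏ j ∈ Finset.Icc 1 k, ((1 / 2 : ℝ) + j - 1)) *
        (4 * (1 / 2 + (k + 1 : ℕ) - 1)) by ring, ← ih, show 2 * (k + 1) = 2 * k + 1 + 1 by ring,
      Nat.factorial_succ, Nat.factorial_succ, Nat.factorial_succ]
    have := Nat.factorial_pos k
    push_cast
    field_simp
    ring

lemma integral_pow_even_varGamma {a : ℝ} (ha : 0 < a) (ρ : ℝ) (k : ℕ) :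
    ∫ x, x ^ (2 * k) ∂varGamma a ρ = ((2 * k).factorial : ℝ) / k.factorial *
      (∏ j ∈ Finset.Icc 1 k, (a + j - 1)) * ρ ^ (2 * k) := by
  have := isProbabilityMeasure_gammaMeasure ha (r := 1 / 2) one_half_pos
  rw [varGamma, integral_map (by fun_prop) (by fun_prop)]
  simp_rw [mul_pow _ _ (2 * k)]
  rw [integral_prod_mul (fun g => ρ ^ (2 * k) * √g ^ (2 * k)) (fun n : ℝ => n ^ (2 * k)),
    integral_const_mul]
  have h : ∫ g, √g ^ (2 * k) ∂gammaMeasure a (1 / 2) = ∫ g, g ^ k ∂gammaMeasure a (1 / 2) := by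
    refine integral_congr_ae ?_
    filter_upwards [ae_pos_gammaMeasure a (1 / 2)] with g hg
    rw [pow_mul, Real.sq_sqrt hg.le]
  -- The rate `1/2` and the normal moment each contribute `2 ^ k`; together with the product over
  -- `1/2 + j - 1` they form `(2k)! / k!`.
  rw [h, integral_pow_gammaMeasure ha one_half_pos, integral_pow_gaussianReal,
    factorial_two_mul_div, show (4 : ℝ) = 2 * 2 by norm_num, mul_pow, one_div_pow]
  field_simp

lemma integral_pow_odd_varGamma {a : ℝ} (ha : 0 < a) (ρ : ℝ) (k : ℕ) :
    ∫ x, x ^ (2 * k + 1) ∂varGamma a ρ = 0 := by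
  have h : ∫ x, x ^ (2 * k + 1) ∂varGamma a ρ = -∫ x, x ^ (2 * k + 1) ∂varGamma a ρ := by
    conv_lhs => rw [← varGamma_neg ha, ← varGamma_map_neg]
    rw [integral_map (by fun_prop) (by fun_prop), ← integral_neg]
    congr 1 with x
    exact Odd.neg_pow ⟨k, rfl⟩ x
  linarith

end VarianceGamma

/-! ### The distribution function of the variance-gamma law. -/

section VarianceGammaCDF

lemma hasDerivAt_equalCorrV {r : ℕ} (hr : 1 ≤ r) {ρ : ℝ} (hρ : 0 < ρ) {z : ℝ} (hz : 0 < z) :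
    HasDerivAt (equalCorrV r ρ) (varGammaPDF ((r : ℝ) / 2) ρ z) z := by
  have h := HasDerivAt.comp (h := fun z : ℝ => z / ρ) z
    (hasDerivAt_equalCorrV_one hr (div_pos hz hρ)) ((hasDerivAt_id z).div_const ρ)
  rw [show equalCorrV r ρ = equalCorrV r 1 ∘ fun z => z / ρ from
    funext fun z => equalCorrV_eq r hρ.ne' z]
  convert! h using 1
  rw [varGammaPDF_of_ne_zero _ _ hz.ne', abs_of_pos (by positivity), abs_of_pos (by positivity),
    show (r : ℝ) / 2 - 1 / 2 = ((r : ℝ) - 1) / 2 by ring, show z / (2 * ρ) = z / ρ / 2 by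
      field_simp]
  field_simp

lemma tendsto_equalCorrV {r : ℕ} (hr : 1 ≤ r) {ρ : ℝ} (hρ : 0 < ρ) :
    Tendsto (equalCorrV r ρ) (𝓝[>] 0) (𝓝 0) := by
  rw [show equalCorrV r ρ = equalCorrV r 1 ∘ fun z => z / ρ from
    funext fun z => equalCorrV_eq r hρ.ne' z]
  refine (tendsto_equalCorrV_one hr).comp (tendsto_nhdsWithin_iff.2 ⟨?_, ?_⟩)
  · have h : Continuous fun x : ℝ => x / ρ := by fun_prop
    have := h.tendsto 0
    rw [zero_div] at this
    exact this.mono_left nhdsWithin_le_nhds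
  · filter_upwards [self_mem_nhdsWithin] with x hx
    exact div_pos hx.out hρ

variable {r : ℕ} {ρ : ℝ}

/-- The fundamental theorem of calculus is used with one-sided limits at the endpoints, because for
`r = 1` the density is unbounded at `0`. -/
lemma varGamma_real_Ioc (hr : 1 ≤ r) (hρ : 0 < ρ) {z : ℝ} (hz : 0 < z) :
    (varGamma ((r : ℝ) / 2) ρ).real (Set.Ioc 0 z) = equalCorrV r ρ z := by
  have hr' : (1 : ℝ) ≤ r := by exact_mod_cast hr
  have ha : 0 < (r : ℝ) / 2 := by positivity
  have hprob := isProbabilityMeasure_varGamma ha ρ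
  have hnn := varGammaPDF_nonneg (a := (r : ℝ) / 2) (by linarith) hρ
  have hmeas := measurable_varGammaPDF ((r : ℝ) / 2) hρ
  have hfin : ∫⁻ x, ENNReal.ofReal (varGammaPDF ((r : ℝ) / 2) ρ x) ≠ ⊤ := by
    have := measure_ne_top (varGamma ((r : ℝ) / 2) ρ) Set.univ
    rwa [varGamma_eq_withDensity ha hρ, withDensity_apply _ MeasurableSet.univ,
      Measure.restrict_univ] at this
  have hint : Integrable (varGammaPDF ((r : ℝ) / 2) ρ) := by
    refine ⟨hmeas.aestronglyMeasurable, ?_⟩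
    rw [hasFiniteIntegral_iff_ofReal (ae_of_all _ hnn)]
    exact hfin.lt_top
  rw [varGamma_eq_withDensity ha hρ, Measure.real, withDensity_apply _ measurableSet_Ioc,
    ← ofReal_integral_eq_lintegral_ofReal hint.integrableOn (ae_of_all _ hnn),
    ENNReal.toReal_ofReal (integral_nonneg hnn), ← intervalIntegral.integral_of_le hz.le,
    intervalIntegral.integral_eq_sub_of_hasDerivAt_of_tendsto hz
      (fun x hx => hasDerivAt_equalCorrV hr hρ hx.1) hint.intervalIntegrable
      (tendsto_equalCorrV hr hρ)
      ((hasDerivAt_equalCorrV hr hρ hz).continuousAt.tendsto.mono_left nhdsWithin_le_nhds),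
    sub_zero]

lemma varGamma_singleton {a : ℝ} (ha : 0 < a) (hρ : 0 < ρ) (x : ℝ) : varGamma a ρ {x} = 0 := by
  rw [varGamma_eq_withDensity ha hρ]
  exact withDensity_absolutelyContinuous _ _ (measure_singleton x)

lemma varGamma_real_Ici {a : ℝ} (ha : 0 < a) (x : ℝ) :
    (varGamma a ρ).real (Set.Ici x) = (varGamma a ρ).real (Set.Iic (-x)) := by
  conv_lhs => rw [← varGamma_neg ha, ← varGamma_map_neg]
  rw [Measure.real, Measure.map_apply (by fun_prop) measurableSet_Ici, Measure.real]
  congr 2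
  ext y
  simp

lemma varGamma_real_Ici_eq_sub {a : ℝ} (ha : 0 < a) (hρ : 0 < ρ) (x : ℝ) :
    (varGamma a ρ).real (Set.Ici x) = 1 - (varGamma a ρ).real (Set.Iic x) := by
  have := isProbabilityMeasure_varGamma ha ρ
  have h : (varGamma a ρ).real (Set.Ici x) = (varGamma a ρ).real (Set.Ioi x) := by
    have hu : Set.Ici x = Set.Ioi x ∪ {x} := by
      ext y
      simp [le_iff_lt_or_eq]
    refine le_antisymm ?_ (measureReal_mono Set.Ioi_subset_Ici_self)
    rw [hu]
    refine (measureReal_union_le _ _).trans ?_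
    rw [Measure.real, Measure.real, varGamma_singleton ha hρ]
    simp
  rw [h, ← Set.compl_Iic, probReal_compl_eq_one_sub measurableSet_Iic]

lemma varGamma_real_Iic (hr : 1 ≤ r) (hρ : 0 < ρ) (x : ℝ) :
    (varGamma ((r : ℝ) / 2) ρ).real (Set.Iic x) =
      if x ≤ 0 then 1 / 2 - equalCorrV r ρ (-x) else 1 / 2 + equalCorrV r ρ x := by
  have hr' : (1 : ℝ) ≤ r := by exact_mod_cast hr
  have ha : 0 < (r : ℝ) / 2 := by positivity
  have := isProbabilityMeasure_varGamma ha ρ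
  -- A symmetric law without atoms puts mass `1/2` on each side of the origin.
  have h0 : (varGamma ((r : ℝ) / 2) ρ).real (Set.Iic 0) = 1 / 2 := by
    have h1 := varGamma_real_Ici (ρ := ρ) ha 0
    have h2 := varGamma_real_Ici_eq_sub ha hρ 0
    rw [neg_zero] at h1
    linarith
  have hpos : ∀ z : ℝ, 0 < z →
      (varGamma ((r : ℝ) / 2) ρ).real (Set.Iic z) = 1 / 2 + equalCorrV r ρ z := by
    intro z hz
    rw [← Set.Iic_union_Ioc_eq_Iic hz.le, measureReal_union (Set.Iic_disjoint_Ioc le_rfl)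
      measurableSet_Ioc, h0, varGamma_real_Ioc hr hρ hz]
  split_ifs with hx
  · rcases hx.eq_or_lt with rfl | hx
    · simp [equalCorrV, h0]
    · have h1 := varGamma_real_Ici (ρ := ρ) ha (-x)
      have h2 := varGamma_real_Ici_eq_sub ha hρ (-x)
      rw [neg_neg] at h1
      rw [hpos (-x) (by linarith)] at h2
      linarith
  · exact hpos x (not_le.1 hx)

end VarianceGammaCDF

/-! ### Characteristic function of a difference of chi-squared variables. -/

section QuadraticForm

lemma integral_cexp_sq_gaussianReal {z : ℂ} (hz : z.re = 0) :
    ∫ x : ℝ, Complex.exp (z * (x : ℂ) ^ 2) ∂gaussianReal 0 1 =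
      ((√(2 * Real.pi))⁻¹ : ℝ) * (Real.pi / (1 / 2 - z)) ^ (1 / 2 : ℂ) := by
  have hb : 0 < (1 / 2 - z).re := by simp [hz]
  rw [integral_gaussianReal_eq_integral_smul one_ne_zero, ← integral_gaussian_complex hb,
    ← integral_const_mul]
  congr 1 with x
  rw [gaussianPDFReal, Complex.real_smul]
  push_cast
  rw [mul_assoc, ← Complex.exp_add]
  congr 2
  · simp
  · simp
    ring

/-- For purely imaginary `z` the two integrals are complex conjugates, so the product is a squared
modulus and no branch of the complex square root has to be tracked. -/
lemma integral_cexp_sq_mul_conj {z : ℂ} (hz : z.re = 0) :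
    (∫ x : ℝ, Complex.exp (z * (x : ℂ) ^ 2) ∂gaussianReal 0 1) *
      (∫ x : ℝ, Complex.exp (-z * (x : ℂ) ^ 2) ∂gaussianReal 0 1) =
      ((1 / (1 + 4 * z.im ^ 2)) ^ (1 / 2 : ℝ) : ℝ) := by
  have hconj : ∫ x : ℝ, Complex.exp (-z * (x : ℂ) ^ 2) ∂gaussianReal 0 1 =
      (starRingEnd ℂ) (∫ x : ℝ, Complex.exp (z * (x : ℂ) ^ 2) ∂gaussianReal 0 1) := by
    rw [← integral_conj]
    congr 1 with x
    rw [← Complex.exp_conj, map_mul, map_pow, Complex.conj_ofReal]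
    congr 2
    apply Complex.ext <;> simp [hz]
  rw [hconj, Complex.mul_conj, Complex.normSq_eq_norm_sq, integral_cexp_sq_gaussianReal hz]
  congr 1
  have hpi := Real.pi_pos
  have hn : ‖(1 / 2 - z : ℂ)‖ = √(1 / 4 + z.im ^ 2) := by
    rw [Complex.norm_def, Complex.normSq_apply]
    simp [hz]
    ring_nf
  have h2 : ‖((Real.pi : ℂ) / (1 / 2 - z)) ^ (1 / 2 : ℂ)‖ ^ 2 =
      Real.pi / √(1 / 4 + z.im ^ 2) := by
    rw [show (1 / 2 : ℂ) = ((1 / 2 : ℝ) : ℂ) by push_cast; rfl, Complex.norm_cpow_real,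
      ← Real.sqrt_eq_rpow, Real.sq_sqrt (norm_nonneg _), norm_div, Complex.norm_real,
      Real.norm_of_nonneg hpi.le, ← hn]
    push_cast
    rfl
  rw [norm_mul, mul_pow, h2, Complex.norm_real, Real.norm_of_nonneg (by positivity), inv_pow,
    Real.sq_sqrt (by positivity), ← Real.sqrt_eq_rpow,
    show (1 / (1 + 4 * z.im ^ 2) : ℝ) = 1 / (2 ^ 2 * (1 / 4 + z.im ^ 2)) by ring_nf,
    Real.sqrt_div one_pos.le, Real.sqrt_one, Real.sqrt_mul (by positivity),
    Real.sqrt_sq (by norm_num)]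
  field_simp

variable {Ω : Type*} [MeasurableSpace Ω] {P : Measure Ω} [IsProbabilityMeasure P]

/-- The law of a difference of two independent, equally scaled chi-squared variables. -/
lemma map_sum_sq_sub_sq {r : ℕ} (hr : 1 ≤ r) (ρ : ℝ) {A : Fin r ⊕ Fin r → Ω → ℝ}
    (hA : iIndepFun A P) (hm : ∀ j, AEMeasurable (A j) P)
    (hlaw : ∀ j, P.map (A j) = gaussianReal 0 1) :
    P.map (fun ω => ∑ i : Fin r, ρ / 2 * (A (Sum.inl i) ω ^ 2 - A (Sum.inr i) ω ^ 2)) =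
      varGamma ((r : ℝ) / 2) ρ := by
  have hr' : (1 : ℝ) ≤ r := by exact_mod_cast hr
  have ha : 0 < (r : ℝ) / 2 := by positivity
  have := isProbabilityMeasure_varGamma ha ρ
  have hmeas : AEMeasurable
      (fun ω => ∑ i : Fin r, ρ / 2 * (A (Sum.inl i) ω ^ 2 - A (Sum.inr i) ω ^ 2)) P :=
    Finset.aemeasurable_fun_sum _ fun i _ =>
      (((hm _).pow_const 2).sub ((hm _).pow_const 2)).const_mul _
  have := Measure.isProbabilityMeasure_map hmeas
  refine Measure.ext_of_charFun (funext fun s => ?_)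
  rw [charFun_varGamma ha, charFun_apply_real, integral_map hmeas (by fun_prop)]
  set z : ℂ := (s * ρ / 2 : ℝ) * Complex.I with hz
  have hz0 : z.re = 0 := by simp [hz]
  have hzi : z.im = s * ρ / 2 := by simp [hz]
  have hprod : ∀ ω, Complex.exp (s * ((∑ i : Fin r, ρ / 2 *
      (A (Sum.inl i) ω ^ 2 - A (Sum.inr i) ω ^ 2) : ℝ) : ℂ) * Complex.I) =
      ∏ j : Fin r ⊕ Fin r, (Sum.elim (fun _ : Fin r => fun x : ℝ => Complex.exp (z * (x : ℂ) ^ 2))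
        (fun _ : Fin r => fun x : ℝ => Complex.exp (-z * (x : ℂ) ^ 2)) j) (A j ω) := by
    intro ω
    rw [Fintype.prod_sum_type]
    simp only [Sum.elim_inl, Sum.elim_inr]
    rw [← Finset.prod_mul_distrib]
    simp_rw [← Complex.exp_add]
    rw [← Complex.exp_sum]
    push_cast
    rw [Finset.mul_sum, Finset.sum_mul, hz]
    congr 1
    refine Finset.sum_congr rfl fun i _ => ?_
    push_cast
    ring
  simp_rw [hprod]
  rw [hA.integral_fun_prod_comp hm]
  · have hi : ∀ j, ∫ ω, (Sum.elim (fun _ : Fin r => fun x : ℝ => Complex.exp (z * (x : ℂ) ^ 2))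
        (fun _ : Fin r => fun x : ℝ => Complex.exp (-z * (x : ℂ) ^ 2)) j) (A j ω) ∂P =
        ∫ x, (Sum.elim (fun _ : Fin r => fun x : ℝ => Complex.exp (z * (x : ℂ) ^ 2))
        (fun _ : Fin r => fun x : ℝ => Complex.exp (-z * (x : ℂ) ^ 2)) j) x
          ∂gaussianReal 0 1 := by
      intro j
      rw [← hlaw j, integral_map (hm j)]
      rcases j with j | j <;> simp only [Sum.elim_inl, Sum.elim_inr] <;> fun_prop
    simp_rw [hi]
    rw [Fintype.prod_sum_type]
    simp only [Sum.elim_inl, Sum.elim_inr, Finset.prod_const, Finset.card_univ, Fintype.card_fin]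
    -- Each of the `r` conjugate pairs contributes `(1 + ρ²s²)^(-1/2)`.
    rw [← mul_pow, integral_cexp_sq_mul_conj hz0, ← Complex.ofReal_pow, ← Real.rpow_natCast,
      ← Real.rpow_mul (by positivity), hzi]
    congr 2
    · ring
    · ring
  · intro j
    rcases j with j | j <;> simp only [Sum.elim_inl, Sum.elim_inr] <;> fun_prop

end QuadraticForm

/-! ### Density of the joint law with respect to the product of its marginals. -/

section Density

/-- The density of a standard bivariate normal law with correlation `ρ` with respect to the product
of its marginals. -/
def corrDensity (ρ s t : ℝ) : ℝ :=
  (√(1 - ρ ^ 2))⁻¹ * Real.exp ((2 * ρ * s * t - ρ ^ 2 * (s ^ 2 + t ^ 2)) / (2 * (1 - ρ ^ 2)))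

lemma corrDensity_pos {ρ : ℝ} (hρ : ρ ^ 2 < 1) (s t : ℝ) : 0 < corrDensity ρ s t := by
  have : 0 < 1 - ρ ^ 2 := by linarith
  rw [corrDensity]
  positivity

@[fun_prop]
lemma measurable_corrDensity {α : Type*} [MeasurableSpace α] {f g : α → ℝ} (ρ : ℝ)
    (hf : Measurable f) (hg : Measurable g) : Measurable fun x => corrDensity ρ (f x) (g x) := by
  unfold corrDensity
  fun_prop

/-- The left side is the conditional law of `T` given `S = s` for a standard bivariate normal pair
with correlation `ρ`; the weight is the quotient of the two normal densities. -/
lemma gaussianReal_eq_withDensity_corrDensity {ρ : ℝ} (hρ : ρ ^ 2 < 1) (s : ℝ) :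
    gaussianReal (ρ * s) (1 - ρ ^ 2).toNNReal =
      (gaussianReal 0 1).withDensity fun t => ENNReal.ofReal (corrDensity ρ s t) := by
  have hσ : 0 < 1 - ρ ^ 2 := by linarith
  have hpi := Real.pi_pos
  have hv : (1 - ρ ^ 2).toNNReal ≠ 0 := by
    rw [Ne, Real.toNNReal_eq_zero, not_le]
    exact hσ
  rw [gaussianReal_of_var_ne_zero _ hv, gaussianReal_of_var_ne_zero _ one_ne_zero,
    ← withDensity_mul _ (measurable_gaussianPDF _ _) (by fun_prop)]
  congr 1 with t
  simp only [Pi.mul_apply, gaussianPDF]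
  rw [← ENNReal.ofReal_mul (gaussianPDFReal_nonneg _ _ _)]
  congr 1
  rw [gaussianPDFReal, gaussianPDFReal, corrDensity, Real.coe_toNNReal _ hσ.le,
    Real.sqrt_mul (by positivity) (1 - ρ ^ 2), NNReal.coe_one, mul_one, mul_inv, mul_one,
    mul_mul_mul_comm, ← Real.exp_add]
  congr 2
  field_simp
  ring

/-- It suffices to compare boxes, on which the integrand is a product of functions of independent
coordinates. -/
lemma pi_withDensity_prod {ι : Type*} [Fintype ι] {α : ι → Type*} [∀ i, MeasurableSpace (α i)]
    (μ : ∀ i, Measure (α i)) [∀ i, IsProbabilityMeasure (μ i)] {f : ∀ i, α i → ENNReal}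
    (hf : ∀ i, Measurable (f i)) [∀ i, SigmaFinite ((μ i).withDensity (f i))] :
    (Measure.pi μ).withDensity (fun x => ∏ i, f i (x i)) =
      Measure.pi fun i => (μ i).withDensity (f i) := by
  classical
  refine (Measure.pi_eq fun s hs => ?_).symm
  rw [withDensity_apply _ (MeasurableSet.univ_pi hs), ← lintegral_indicator
    (MeasurableSet.univ_pi hs)]
  have hind : iIndepFun (fun i (x : ∀ i, α i) => (s i).indicator (f i) (x i)) (Measure.pi μ) :=
    iIndepFun_pi fun i => ((hf i).indicator (hs i)).aemeasurable
  have h := lintegral_prod_eq_prod_lintegral_of_indepFun Finset.univ _ hind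
    fun i => ((hf i).indicator (hs i)).comp (measurable_pi_apply i)
  calc _ = ∫⁻ x, ∏ i, (s i).indicator (f i) (x i) ∂Measure.pi μ := by
        refine lintegral_congr fun x => ?_
        by_cases hx : x ∈ Set.univ.pi s
        · rw [Set.indicator_of_mem hx]
          exact Finset.prod_congr rfl fun i _ => (Set.indicator_of_mem (hx i trivial) _).symm
        · rw [Set.indicator_of_notMem hx]
          obtain ⟨i, hi⟩ : ∃ i, x i ∉ s i := by simpa [Set.mem_univ_pi] using hx
          exact (Finset.prod_eq_zero (Finset.mem_univ i) (Set.indicator_of_notMem hi _)).symm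
    _ = ∏ i, ∫⁻ x, (s i).indicator (f i) (x i) ∂Measure.pi μ := h
    _ = _ := by
        refine Finset.prod_congr rfl fun i _ => ?_
        rw [withDensity_apply _ (hs i), ← lintegral_indicator (hs i),
          ← (measurePreserving_eval μ i).map_eq, lintegral_map ((hf i).indicator (hs i))
            (measurable_pi_apply i)]

lemma map_pi_gaussian_eq_withDensity {r : ℕ} {ρ : ℝ} (hρ : ρ ^ 2 < 1) (s : Fin r → ℝ) :
    (Measure.pi fun _ : Fin r => gaussianReal 0 1).map
        (fun w i => ρ * s i + √(1 - ρ ^ 2) * w i) =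
      (Measure.pi fun _ : Fin r => gaussianReal 0 1).withDensity
        fun t => ∏ i, ENNReal.ofReal (corrDensity ρ (s i) (t i)) := by
  have hσ : 0 < 1 - ρ ^ 2 := by linarith
  have h : ∀ i, (gaussianReal 0 1).map (fun w => ρ * s i + √(1 - ρ ^ 2) * w) =
      (gaussianReal 0 1).withDensity fun t => ENNReal.ofReal (corrDensity ρ (s i) t) := by
    intro i
    rw [← gaussianReal_eq_withDensity_corrDensity hρ,
      show (fun w => ρ * s i + √(1 - ρ ^ 2) * w) =
        (fun w => ρ * s i + w) ∘ fun w => √(1 - ρ ^ 2) * w from rfl,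
      ← Measure.map_map (by fun_prop) (by fun_prop), gaussianReal_map_const_mul,
      gaussianReal_map_const_add, mul_zero, zero_add, mul_one]
    congr 1
    ext
    rw [Real.coe_toNNReal _ hσ.le, NNReal.coe_mk, Real.sq_sqrt hσ.le]
  have hp : ∀ i, IsProbabilityMeasure ((gaussianReal 0 1).withDensity
      fun t => ENNReal.ofReal (corrDensity ρ (s i) t)) := by
    intro i
    rw [← gaussianReal_eq_withDensity_corrDensity hρ]
    infer_instance
  rw [pi_withDensity_prod (fun _ : Fin r => gaussianReal 0 1)
    (f := fun i t => ENNReal.ofReal (corrDensity ρ (s i) t)) (fun i => by fun_prop)]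
  simp_rw [← h]
  have : ∀ i, SigmaFinite ((gaussianReal 0 1).map fun w => ρ * s i + √(1 - ρ ^ 2) * w) := by
    intro i
    rw [h]
    infer_instance
  exact Measure.pi_map_pi (μ := fun _ => gaussianReal 0 1)
    (f := fun i w => ρ * s i + √(1 - ρ ^ 2) * w) (fun i => by fun_prop)

variable {Ω E F G : Type*} [MeasurableSpace Ω] [MeasurableSpace E] [MeasurableSpace F]
  [MeasurableSpace G] {P : Measure Ω} [IsProbabilityMeasure P]

/-- If `X` influences `Y` only through a Gaussian noisy copy `T = ρ S + √(1 - ρ²) W` of a function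
`S` of `X`, then the joint law has the bivariate normal density of `(S, T)` with respect to the
product of the marginals. -/
lemma map_prodMk_eq_withDensity {r : ℕ} {ρ : ℝ} (hρ : ρ ^ 2 < 1) {X : Ω → E} {Y : Ω → F}
    {Z : Ω → G} {W T : Ω → Fin r → ℝ} {L : E → Fin r → ℝ} {L' : F → Fin r → ℝ}
    {h : G × (Fin r → ℝ) → F} (hL : Measurable L) (hL' : Measurable L') (hh : Measurable h)
    (hX : AEMeasurable X P) (hZ : AEMeasurable Z P) (hW : AEMeasurable W P)
    (hY : ∀ ω, Y ω = h (Z ω, T ω)) (hT : ∀ ω, T ω = L' (Y ω))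
    (hTW : ∀ ω, T ω = fun i => ρ * L (X ω) i + √(1 - ρ ^ 2) * W ω i)
    (hXZW : IndepFun X (fun ω => (Z ω, W ω)) P) (hZW : IndepFun Z W P) (hZT : IndepFun Z T P)
    (hWlaw : P.map W = Measure.pi fun _ => gaussianReal 0 1)
    (hTlaw : P.map T = Measure.pi fun _ => gaussianReal 0 1) :
    P.map (fun ω => (X ω, Y ω)) = ((P.map X).prod (P.map Y)).withDensity
      fun z => ∏ i, ENNReal.ofReal (corrDensity ρ (L z.1 i) (L' z.2 i)) := by
  have hTm : AEMeasurable T P := by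
    rw [funext hTW]
    refine aemeasurable_pi_lambda _ fun i => ?_
    exact (((measurable_pi_apply i).comp hL).comp_aemeasurable hX |>.const_mul ρ).add
      (((measurable_pi_apply i).comp_aemeasurable hW).const_mul _)
  have hYm : AEMeasurable Y P := by
    rw [funext hY]
    exact hh.comp_aemeasurable (hZ.prodMk hTm)
  have hPX := Measure.isProbabilityMeasure_map hX
  have hPY := Measure.isProbabilityMeasure_map hYm
  have hPZ := Measure.isProbabilityMeasure_map hZ
  have hZWlaw := (indepFun_iff_map_prod_eq_prod_map_map hZ hW).1 hZW
  have hZTlaw := (indepFun_iff_map_prod_eq_prod_map_map hZ hTm).1 hZT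
  have hXZWlaw := (indepFun_iff_map_prod_eq_prod_map_map hX (hZ.prodMk hW)).1 hXZW
  rw [hZWlaw, hWlaw] at hXZWlaw
  rw [hTlaw] at hZTlaw
  have hφ : Measurable fun z : E × F =>
      ∏ i, ENNReal.ofReal (corrDensity ρ (L z.1 i) (L' z.2 i)) := by fun_prop
  refine Measure.ext_of_lintegral _ fun f hf => ?_
  -- `Y` is a function of `X`, `Z` and `W`, which are mutually independent, so the expectation
  -- becomes an iterated integral.
  have hleft : ∫⁻ z, f z ∂P.map (fun ω => (X ω, Y ω)) =
      ∫⁻ x, ∫⁻ z, ∫⁻ w, f (x, h (z, fun i => ρ * L x i + √(1 - ρ ^ 2) * w i))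
        ∂(Measure.pi fun _ : Fin r => gaussianReal 0 1) ∂P.map Z ∂P.map X := by
    have hg : Measurable fun u : E × G × (Fin r → ℝ) =>
        f (u.1, h (u.2.1, fun i => ρ * L u.1 i + √(1 - ρ ^ 2) * u.2.2 i)) := by fun_prop
    rw [lintegral_map' hf.aemeasurable (hX.prodMk hYm)]
    calc _ = ∫⁻ ω, f (X ω, h (Z ω, fun i => ρ * L (X ω) i + √(1 - ρ ^ 2) * W ω i)) ∂P := by
          refine lintegral_congr fun ω => ?_
          rw [hY, hTW]
      _ = ∫⁻ u, f (u.1, h (u.2.1, fun i => ρ * L u.1 i + √(1 - ρ ^ 2) * u.2.2 i))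
          ∂P.map (fun ω => (X ω, (Z ω, W ω))) :=
          (lintegral_map' hg.aemeasurable (hX.prodMk (hZ.prodMk hW))).symm
      _ = _ := by
          rw [hXZWlaw, lintegral_prod _ hg.aemeasurable]
          refine lintegral_congr fun x => ?_
          rw [lintegral_prod _ (by fun_prop)]
  rw [hleft, lintegral_withDensity_eq_lintegral_mul _ hφ hf,
    lintegral_prod _ (hφ.mul hf).aemeasurable]
  refine lintegral_congr fun x => ?_
  have hk : Measurable fun u : G × (Fin r → ℝ) =>
      (∏ i, ENNReal.ofReal (corrDensity ρ (L x i) (u.2 i))) * f (x, h u) := by fun_prop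
  -- For fixed `x`, the noise `w` is traded for `t = ρ L x + √(1 - ρ²) w`, whose law has a density
  -- with respect to the law of `T`. As `Z` and `T` are independent, `(z, t)` then has the law of
  -- `(Z, T)`, and `h` reassembles `Y`, now integrated independently of `x`.
  calc ∫⁻ z, ∫⁻ w, f (x, h (z, fun i => ρ * L x i + √(1 - ρ ^ 2) * w i))
        ∂(Measure.pi fun _ : Fin r => gaussianReal 0 1) ∂P.map Z
      = ∫⁻ z, ∫⁻ t, (∏ i, ENNReal.ofReal (corrDensity ρ (L x i) (t i))) * f (x, h (z, t))
        ∂(Measure.pi fun _ : Fin r => gaussianReal 0 1) ∂P.map Z := by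
        refine lintegral_congr fun z => ?_
        have h1 := lintegral_map (μ := Measure.pi fun _ : Fin r => gaussianReal 0 1)
          (f := fun t => f (x, h (z, t))) (g := fun w i => ρ * L x i + √(1 - ρ ^ 2) * w i)
          (by fun_prop) (by fun_prop)
        rw [← h1, map_pi_gaussian_eq_withDensity hρ, lintegral_withDensity_eq_lintegral_mul _
          (by fun_prop) (by fun_prop)]
        rfl
    _ = ∫⁻ u, (∏ i, ENNReal.ofReal (corrDensity ρ (L x i) (u.2 i))) * f (x, h u)
        ∂P.map (fun ω => (Z ω, T ω)) := by
        rw [hZTlaw, lintegral_prod _ hk.aemeasurable]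
    _ = ∫⁻ ω, (∏ i, ENNReal.ofReal (corrDensity ρ (L x i) (T ω i))) * f (x, h (Z ω, T ω)) ∂P :=
        lintegral_map' hk.aemeasurable (hZ.prodMk hTm)
    _ = ∫⁻ ω, (∏ i, ENNReal.ofReal (corrDensity ρ (L x i) (L' (Y ω) i))) * f (x, Y ω) ∂P := by
        refine lintegral_congr fun ω => ?_
        rw [← hT, ← hY]
    _ = _ := by
        rw [lintegral_map' (by fun_prop) hYm]
        rfl

end Density

/-! ### Whitening and singular vectors. -/

section LinearAlgebra

open Matrix

/-- A matrix all of whose positive singular values equal `ρ` is `ρ` times a partial isometry. -/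
lemma exists_eq_smul_mul_transpose {p q r : ℕ} (M : Matrix (Fin p) (Fin q) ℝ)
    (hr : r = Module.finrank ℝ (LinearMap.range (Matrix.toEuclideanLin M))) (hr1 : 1 ≤ r) {ρ : ℝ}
    (hρ : ∀ i : ℕ, i < r → (Matrix.toEuclideanLin M).singularValues i = ρ) :
    0 < ρ ∧ ∃ (U : Matrix (Fin p) (Fin r) ℝ) (V : Matrix (Fin q) (Fin r) ℝ),
      Uᵀ * U = 1 ∧ Vᵀ * V = 1 ∧ M = ρ • (U * Vᵀ) := by
  set T := Matrix.toEuclideanLin M with hT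
  have hρ0 : 0 < ρ := by
    rw [← hρ 0 (by omega), LinearMap.singularValues_pos_iff_lt_finrank_range, ← hr]
    omega
  refine ⟨hρ0, ?_⟩
  have hn : Module.finrank ℝ (EuclideanSpace ℝ (Fin q)) = q := by simp
  have hrq : r ≤ q := hr.le.trans ((LinearMap.finrank_range_le T).trans hn.le)
  -- The right singular vectors are the eigenvectors of `T* T`; their images are orthogonal with
  -- squared lengths the squared singular values.
  set e := T.isSymmetric_adjoint_comp_self.eigenvectorBasis hn with he
  have hinner : ∀ i j : Fin q, inner ℝ (T (e i)) (T (e j)) =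
      T.singularValues j ^ 2 * if i = j then 1 else 0 := by
    intro i j
    have h1 := T.isSymmetric_adjoint_comp_self.apply_eigenvectorBasis hn j
    rw [← T.sq_singularValues_fin hn j] at h1
    rw [← LinearMap.adjoint_inner_right, ← LinearMap.comp_apply, h1, inner_smul_right,
      orthonormal_iff_ite.1 e.orthonormal]
    rfl
  have hzero : ∀ j : Fin q, r ≤ j → T (e j) = 0 := by
    intro j hj
    have h1 := hinner j j
    rw [T.singularValues_eq_zero_iff_le_finrank_range.2 (hr.ge.trans hj)] at h1
    simpa using h1
  set c : Fin r → Fin q := Fin.castLE hrq with hc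
  -- The columns of `V` are the first `r` right singular vectors and those of `U` their normalized
  -- images; the other singular vectors lie in the kernel.
  refine ⟨Matrix.of fun i k => ρ⁻¹ * T (e (c k)) i, Matrix.of fun j k => e (c k) j, ?_, ?_, ?_⟩
  · ext k l
    have h1 := hinner (c k) (c l)
    have h2 : T.singularValues (c l) = ρ := hρ l l.2
    rw [h2, PiLp.inner_apply] at h1
    simp only [RCLike.inner_apply, conj_trivial] at h1
    simp only [Matrix.mul_apply, Matrix.transpose_apply, Matrix.of_apply, Matrix.one_apply]
    have h3 : (c k = c l) ↔ k = l := (Fin.castLE_injective hrq).eq_iff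
    simp only [h3] at h1
    calc _ = ρ⁻¹ ^ 2 * ∑ i, T (e (c l)) i * T (e (c k)) i := by
          rw [Finset.mul_sum]
          exact Finset.sum_congr rfl fun i _ => by ring
      _ = _ := by
          rw [h1]
          field_simp
  · ext k l
    have h1 := orthonormal_iff_ite.1 e.orthonormal (c k) (c l)
    rw [PiLp.inner_apply] at h1
    simp only [RCLike.inner_apply, conj_trivial] at h1
    have h3 : (c k = c l) ↔ k = l := (Fin.castLE_injective hrq).eq_iff
    simp only [h3] at h1
    simp only [Matrix.mul_apply, Matrix.transpose_apply, Matrix.of_apply, Matrix.one_apply]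
    rw [← h1]
    exact Finset.sum_congr rfl fun i _ => mul_comm _ _
  · ext i j
    have h1 : T (EuclideanSpace.single j 1) i = M i j := by
      simp [hT, Matrix.toLpLin_apply]
    have h2 : T (EuclideanSpace.single j 1) = ∑ k, e k j • T (e k) := by
      conv_lhs => rw [← e.sum_repr' (EuclideanSpace.single j 1)]
      rw [map_sum]
      refine Finset.sum_congr rfl fun k _ => ?_
      rw [map_smul]
      congr 1
      simp [EuclideanSpace.inner_single_right]
    have h3 : ∑ k, e k j • T (e k) = ∑ k, e (c k) j • T (e (c k)) := by
      refine (Fintype.sum_of_injective c (Fin.castLE_injective hrq) _ _ (fun k hk => ?_)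
        fun _ => rfl).symm
      rw [hzero k, smul_zero]
      by_contra hlt
      exact hk ⟨⟨k, not_le.1 hlt⟩, rfl⟩
    rw [← h1, h2, h3]
    simp only [Matrix.smul_apply, Matrix.mul_apply, Matrix.transpose_apply, Matrix.of_apply,
      smul_eq_mul, WithLp.ofLp_sum, Finset.sum_apply, WithLp.ofLp_smul, Pi.smul_apply,
      Finset.mul_sum]
    refine Finset.sum_congr rfl fun k _ => ?_
    field_simp

open scoped MatrixOrder in
lemma sqrt_spec {n : ℕ} {R : Matrix (Fin n) (Fin n) ℝ} (hR : R.PosSemidef) (hdet : R.det ≠ 0) :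
    CFC.sqrt R * CFC.sqrt R = R ∧ (CFC.sqrt R)ᵀ = CFC.sqrt R ∧ IsUnit (CFC.sqrt R).det := by
  have h1 : CFC.sqrt R * CFC.sqrt R = R := CFC.sqrt_mul_sqrt_self R hR.nonneg
  refine ⟨h1, ?_, ?_⟩
  · have h2 : (CFC.sqrt R).PosSemidef := Matrix.nonneg_iff_posSemidef.1 (CFC.sqrt_nonneg R)
    have := h2.isHermitian.eq
    rwa [Matrix.conjTranspose_eq_transpose_of_trivial] at this
  · have := congrArg Matrix.det h1
    rw [Matrix.det_mul] at this
    refine isUnit_iff_ne_zero.2 fun h => hdet ?_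
    rw [← this, h, zero_mul]

open scoped MatrixOrder in
/-- Canonical variables in the case of equal canonical correlations. -/
lemma exists_canonical {p q r : ℕ} {Rx : Matrix (Fin p) (Fin p) ℝ} {Ry : Matrix (Fin q) (Fin q) ℝ}
    {Rxy : Matrix (Fin p) (Fin q) ℝ} (hRx : Rx.PosSemidef) (hRy : Ry.PosSemidef)
    (hx : Rx.det ≠ 0) (hy : Ry.det ≠ 0) (hr : r = Rxy.rank) (hr1 : 1 ≤ r) {ρ : ℝ}
    (hρ : ∀ i : ℕ, i < r → (Matrix.toEuclideanLin
      ((CFC.sqrt Rx)⁻¹ * Rxy * (CFC.sqrt Ry)⁻¹)).singularValues i = ρ) :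
    0 < ρ ∧ ∃ (A : Matrix (Fin p) (Fin r) ℝ) (B : Matrix (Fin q) (Fin r) ℝ),
      Aᵀ * Rx * A = 1 ∧ Bᵀ * Ry * B = 1 ∧ Rxy = ρ • (Rx * A * Bᵀ * Ry) := by
  obtain ⟨hx1, hx2, hx3⟩ := sqrt_spec hRx hx
  obtain ⟨hy1, hy2, hy3⟩ := sqrt_spec hRy hy
  set Q := CFC.sqrt Rx
  set Q' := CFC.sqrt Ry
  have hQ1 : Q⁻¹ * Q = 1 := Matrix.nonsing_inv_mul _ hx3
  have hQ2 : Q * Q⁻¹ = 1 := Matrix.mul_nonsing_inv _ hx3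
  have hQ'1 : Q'⁻¹ * Q' = 1 := Matrix.nonsing_inv_mul _ hy3
  have hQ'2 : Q' * Q'⁻¹ = 1 := Matrix.mul_nonsing_inv _ hy3
  have hQt : (Q⁻¹)ᵀ = Q⁻¹ := by rw [Matrix.transpose_nonsing_inv, hx2]
  have hQt' : (Q'⁻¹)ᵀ = Q'⁻¹ := by rw [Matrix.transpose_nonsing_inv, hy2]
  have hrank : (Q⁻¹ * Rxy * Q'⁻¹).rank = Rxy.rank := by
    rw [Matrix.rank_mul_eq_left_of_isUnit_det _ _ (Matrix.isUnit_nonsing_inv_det _ hy3),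
      Matrix.rank_mul_eq_right_of_isUnit_det _ _ (Matrix.isUnit_nonsing_inv_det _ hx3)]
  obtain ⟨hρ0, U, V, hU, hV, hM⟩ := exists_eq_smul_mul_transpose (Q⁻¹ * Rxy * Q'⁻¹)
    (r := r) (by rw [hr, ← hrank, Matrix.rank_eq_finrank_range_toLin _
      (EuclideanSpace.basisFun _ ℝ).toBasis (EuclideanSpace.basisFun _ ℝ).toBasis,
      Matrix.toEuclideanLin_eq_toLin_orthonormal]) hr1 hρ
  -- Undoing the whitening: `Q⁻¹ U` is orthonormal for the form `Q² = Rx`, and likewise on the other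
  -- side.
  refine ⟨hρ0, Q⁻¹ * U, Q'⁻¹ * V, ?_, ?_, ?_⟩
  · rw [Matrix.transpose_mul, hQt, ← hx1]
    calc Uᵀ * Q⁻¹ * (Q * Q) * (Q⁻¹ * U) = Uᵀ * (Q⁻¹ * Q) * (Q * Q⁻¹) * U := by
          simp only [Matrix.mul_assoc]
      _ = 1 := by rw [hQ1, hQ2, Matrix.mul_one, Matrix.mul_one, hU]
  · rw [Matrix.transpose_mul, hQt', ← hy1]
    calc Vᵀ * Q'⁻¹ * (Q' * Q') * (Q'⁻¹ * V) = Vᵀ * (Q'⁻¹ * Q') * (Q' * Q'⁻¹) * V := by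
          simp only [Matrix.mul_assoc]
      _ = 1 := by rw [hQ'1, hQ'2, Matrix.mul_one, Matrix.mul_one, hV]
  · rw [Matrix.transpose_mul, hQt']
    calc Rxy = Q * (Q⁻¹ * Rxy * Q'⁻¹) * Q' := by
          rw [show Q * (Q⁻¹ * Rxy * Q'⁻¹) * Q' = (Q * Q⁻¹) * Rxy * (Q'⁻¹ * Q') by
            simp only [Matrix.mul_assoc], hQ2, hQ'1, Matrix.one_mul, Matrix.mul_one]
      _ = ρ • (Q * (U * Vᵀ) * Q') := by rw [hM, Matrix.mul_smul, Matrix.smul_mul]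
      _ = ρ • (Q * (Q * Q⁻¹) * (U * Vᵀ) * ((Q'⁻¹ * Q') * Q')) := by
          rw [hQ2, hQ'1, Matrix.mul_one, Matrix.one_mul]
      _ = ρ • (Q * Q * (Q⁻¹ * U) * (Vᵀ * Q'⁻¹) * (Q' * Q')) := by
          simp only [Matrix.mul_assoc]
      _ = _ := by rw [hx1, hy1]

end LinearAlgebra

/-! ### Bilinearity of cross-covariance matrices. -/

section CovarianceMatrix

open Matrix

variable {Ω : Type*} [MeasurableSpace Ω] {P : Measure Ω} {ι κ l : Type*}

/-- The cross-covariance matrix of two random families. -/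
def covMat (P : Measure Ω) (U : Ω → ι → ℝ) (V : Ω → κ → ℝ) : Matrix ι κ ℝ :=
  Matrix.of fun i j => cov[fun ω => U ω i, fun ω => V ω j; P]

lemma covMat_transpose (U : Ω → ι → ℝ) (V : Ω → κ → ℝ) : (covMat P U V)ᵀ = covMat P V U := by
  ext i j
  exact covariance_comm _ _

variable {U U' : Ω → ι → ℝ} {V V' : Ω → κ → ℝ}

lemma covMat_mulVec_left [IsProbabilityMeasure P] [Fintype ι] (hU : ∀ i, MemLp (fun ω => U ω i) 2 P)
    (hV : ∀ i, MemLp (fun ω => V ω i) 2 P) (C : Matrix l ι ℝ) :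
    covMat P (fun ω => C *ᵥ U ω) V = C * covMat P U V := by
  ext i j
  simp only [covMat, Matrix.of_apply, Matrix.mul_apply, Matrix.mulVec, dotProduct]
  rw [covariance_fun_sum_left (fun k => (hU k).const_mul (C i k)) (hV j)]
  simp_rw [covariance_const_mul_left]

lemma covMat_mulVec_right [IsProbabilityMeasure P] [Fintype κ] (hU : ∀ i, MemLp (fun ω => U ω i) 2 P)
    (hV : ∀ i, MemLp (fun ω => V ω i) 2 P) (C : Matrix l κ ℝ) :
    covMat P U (fun ω => C *ᵥ V ω) = covMat P U V * Cᵀ := by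
  rw [← covMat_transpose, covMat_mulVec_left hV hU, Matrix.transpose_mul, covMat_transpose]

lemma covMat_add_left [IsProbabilityMeasure P] (hU : ∀ i, MemLp (fun ω => U ω i) 2 P)
    (hU' : ∀ i, MemLp (fun ω => U' ω i) 2 P) (hV : ∀ i, MemLp (fun ω => V ω i) 2 P) :
    covMat P (fun ω => U ω + U' ω) V = covMat P U V + covMat P U' V := by
  ext i j
  exact covariance_add_left (hU i) (hU' i) (hV j)

lemma covMat_add_right [IsProbabilityMeasure P] (hU : ∀ i, MemLp (fun ω => U ω i) 2 P)
    (hV : ∀ i, MemLp (fun ω => V ω i) 2 P) (hV' : ∀ i, MemLp (fun ω => V' ω i) 2 P) :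
    covMat P U (fun ω => V ω + V' ω) = covMat P U V + covMat P U V' := by
  rw [← covMat_transpose, covMat_add_left hV hV' hU, Matrix.transpose_add, covMat_transpose,
    covMat_transpose]

lemma covMat_smul_left (c : ℝ) : covMat P (fun ω => c • U ω) V = c • covMat P U V := by
  ext i j
  exact covariance_const_mul_left c

lemma covMat_smul_right (c : ℝ) : covMat P U (fun ω => c • V ω) = c • covMat P U V := by
  ext i j
  exact covariance_const_mul_right c

end CovarianceMatrix

/-! ### Jointly Gaussian families: independence and standard laws from covariances. -/

section GaussianFamilies

open Matrix

variable {Ω : Type*} [MeasurableSpace Ω] {P : Measure Ω} {ι κ : Type*}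

lemma _root_.ProbabilityTheory.HasGaussianLaw.isLinearMap_comp {E F : Type*}
    [NormedAddCommGroup E] [NormedSpace ℝ E] [FiniteDimensional ℝ E] [MeasurableSpace E]
    [BorelSpace E] [NormedAddCommGroup F] [NormedSpace ℝ F] [MeasurableSpace F]
    [BorelSpace F] {G : Ω → E} (hG : HasGaussianLaw G P) {f : E → F} (hf : IsLinearMap ℝ f) :
    HasGaussianLaw (fun ω => f (G ω)) P :=
  hG.map_fun (LinearMap.toContinuousLinearMap (IsLinearMap.mk' f hf))

lemma memLp_two_of_hasGaussianLaw [Fintype ι] {U : Ω → ι → ℝ} (hU : HasGaussianLaw U P) (i : ι) :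
    MemLp (fun ω => U ω i) 2 P :=
  (hU.map_fun (ContinuousLinearMap.proj (R := ℝ) i)).memLp_two

lemma indepFun_of_covMat_eq_zero [Fintype ι] [Fintype κ] {U : Ω → ι → ℝ} {V : Ω → κ → ℝ}
    (hUV : HasGaussianLaw (fun ω => (U ω, V ω)) P) (h : covMat P U V = 0) : IndepFun U V P :=
  hUV.indepFun_of_covariance_eval (X := fun i ω => U ω i) (Y := fun j ω => V ω j)
    fun i j => congrFun (congrFun h i) j

variable [Fintype ι] [DecidableEq ι] {U : Ω → ι → ℝ}

lemma iIndepFun_of_covMat_eq_one (hU : HasGaussianLaw U P) (h : covMat P U U = 1) :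
    iIndepFun (fun i ω => U ω i) P :=
  HasGaussianLaw.iIndepFun_of_covariance_eq_zero (X := fun i ω => U ω i) hU fun i j hij => by
    have := congrFun (congrFun h i) j
    rwa [Matrix.one_apply_ne hij] at this

lemma map_eval_of_covMat_eq_one (hU : HasGaussianLaw U P) (h0 : ∀ i, ∫ ω, U ω i ∂P = 0)
    (h : covMat P U U = 1) (i : ι) : P.map (fun ω => U ω i) = gaussianReal 0 1 := by
  have hg : HasGaussianLaw (fun ω => U ω i) P :=
    hU.map_fun (ContinuousLinearMap.proj (R := ℝ) i)
  have h1 := congrFun (congrFun h i) i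
  rw [Matrix.one_apply_eq] at h1
  rw [hg.map_eq_gaussianReal, h0, ← covariance_self hg.aemeasurable]
  simp only [covMat, Matrix.of_apply] at h1
  rw [h1, Real.toNNReal_one]

lemma map_eq_pi_of_covMat_eq_one [IsProbabilityMeasure P] (hU : HasGaussianLaw U P)
    (h0 : ∀ i, ∫ ω, U ω i ∂P = 0) (h : covMat P U U = 1) :
    P.map U = Measure.pi fun _ => gaussianReal 0 1 := by
  have hm : ∀ i, AEMeasurable (fun ω => U ω i) P := fun i =>
    (memLp_two_of_hasGaussianLaw hU i).aestronglyMeasurable.aemeasurable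
  have := (iIndepFun_iff_map_fun_eq_pi_map hm).1 (iIndepFun_of_covMat_eq_one hU h)
  simp_rw [map_eval_of_covMat_eq_one hU h0 h] at this
  exact this

end GaussianFamilies

/-! ### Covariances of the canonical variables and the diagonalized quadratic form. -/

section CanonicalVariables

open Matrix

/-- Centered jointly Gaussian families `x`, `y` together with matrices of canonical variables, all
of whose canonical correlations are equal to `ρ`. -/
structure IsCanonical {Ω : Type*} [MeasurableSpace Ω] (P : Measure Ω) {p q r : ℕ}
    (x : Ω → Fin p → ℝ) (y : Ω → Fin q → ℝ) (A : Matrix (Fin p) (Fin r) ℝ)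
    (B : Matrix (Fin q) (Fin r) ℝ) (ρ : ℝ) : Prop where
  gaussian : HasGaussianLaw (fun ω => (x ω, y ω)) P
  mean_left : ∀ i, ∫ ω, x ω i ∂P = 0
  mean_right : ∀ i, ∫ ω, y ω i ∂P = 0
  cov_left : Aᵀ * covMat P x x * A = 1
  cov_right : Bᵀ * covMat P y y * B = 1
  cov_cross : covMat P x y = ρ • (covMat P x x * A * Bᵀ * covMat P y y)

namespace IsCanonical

variable {Ω : Type*} [MeasurableSpace Ω] {P : Measure Ω} {p q r : ℕ}
  {x : Ω → Fin p → ℝ} {y : Ω → Fin q → ℝ} {A : Matrix (Fin p) (Fin r) ℝ}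
  {B : Matrix (Fin q) (Fin r) ℝ} {ρ : ℝ}

lemma comp_gaussian (h : IsCanonical P x y A B ρ) {F : Type*} [NormedAddCommGroup F] [NormedSpace ℝ F] [MeasurableSpace F]
    [BorelSpace F] {f : (Fin p → ℝ) × (Fin q → ℝ) → F} (hf : IsLinearMap ℝ f) :
    HasGaussianLaw (fun ω => f (x ω, y ω)) P :=
  h.gaussian.isLinearMap_comp hf

lemma memLp (h : IsCanonical P x y A B ρ) {ι : Type*} [Fintype ι] {f : (Fin p → ℝ) × (Fin q → ℝ) → ι → ℝ}
    (hf : IsLinearMap ℝ f) (i : ι) : MemLp (fun ω => f (x ω, y ω) i) 2 P :=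
  memLp_two_of_hasGaussianLaw (h.comp_gaussian hf) i

lemma memLp_x (h : IsCanonical P x y A B ρ) (i : Fin p) : MemLp (fun ω => x ω i) 2 P :=
  h.memLp (f := Prod.fst) (LinearMap.fst ℝ _ _).isLinear i

lemma memLp_y (h : IsCanonical P x y A B ρ) (i : Fin q) : MemLp (fun ω => y ω i) 2 P :=
  h.memLp (f := Prod.snd) (LinearMap.snd ℝ _ _).isLinear i

lemma memLp_S (h : IsCanonical P x y A B ρ) (i : Fin r) : MemLp (fun ω => (Aᵀ *ᵥ x ω) i) 2 P :=
  h.memLp (f := fun z => Aᵀ *ᵥ z.1) ⟨fun _ _ => by simp [Matrix.mulVec_add],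
    fun _ _ => by simp [Matrix.mulVec_smul]⟩ i

lemma memLp_T (h : IsCanonical P x y A B ρ) (i : Fin r) : MemLp (fun ω => (Bᵀ *ᵥ y ω) i) 2 P :=
  h.memLp (f := fun z => Bᵀ *ᵥ z.2) ⟨fun _ _ => by simp [Matrix.mulVec_add],
    fun _ _ => by simp [Matrix.mulVec_smul]⟩ i

lemma integral_S [IsProbabilityMeasure P] (h : IsCanonical P x y A B ρ) (i : Fin r) : ∫ ω, (Aᵀ *ᵥ x ω) i ∂P = 0 := by
  simp only [Matrix.mulVec, dotProduct]
  rw [integral_finsetSum _ fun k _ => ((h.memLp_x k).integrable one_le_two).const_mul _]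
  simp [integral_const_mul, h.mean_left]

lemma integral_T [IsProbabilityMeasure P] (h : IsCanonical P x y A B ρ) (i : Fin r) : ∫ ω, (Bᵀ *ᵥ y ω) i ∂P = 0 := by
  simp only [Matrix.mulVec, dotProduct]
  rw [integral_finsetSum _ fun k _ => ((h.memLp_y k).integrable one_le_two).const_mul _]
  simp [integral_const_mul, h.mean_right]

lemma covMat_SS [IsProbabilityMeasure P] (h : IsCanonical P x y A B ρ) : covMat P (fun ω => Aᵀ *ᵥ x ω) (fun ω => Aᵀ *ᵥ x ω) = 1 := by
  rw [covMat_mulVec_left h.memLp_x h.memLp_S, covMat_mulVec_right h.memLp_x h.memLp_x,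
    Matrix.transpose_transpose, ← Matrix.mul_assoc, h.cov_left]

lemma covMat_TT [IsProbabilityMeasure P] (h : IsCanonical P x y A B ρ) : covMat P (fun ω => Bᵀ *ᵥ y ω) (fun ω => Bᵀ *ᵥ y ω) = 1 := by
  rw [covMat_mulVec_left h.memLp_y h.memLp_T, covMat_mulVec_right h.memLp_y h.memLp_y,
    Matrix.transpose_transpose, ← Matrix.mul_assoc, h.cov_right]

lemma covMat_xT [IsProbabilityMeasure P] (h : IsCanonical P x y A B ρ) : covMat P x (fun ω => Bᵀ *ᵥ y ω) = ρ • (covMat P x x * A) := by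
  rw [covMat_mulVec_right h.memLp_x h.memLp_y, Matrix.transpose_transpose, h.cov_cross,
    Matrix.smul_mul, Matrix.mul_assoc _ Bᵀ, Matrix.mul_assoc _ (Bᵀ * covMat P y y), h.cov_right,
    Matrix.mul_one]

lemma covMat_ST [IsProbabilityMeasure P] (h : IsCanonical P x y A B ρ) : covMat P (fun ω => Aᵀ *ᵥ x ω) (fun ω => Bᵀ *ᵥ y ω) = ρ • 1 := by
  rw [covMat_mulVec_left h.memLp_x h.memLp_T, h.covMat_xT, Matrix.mul_smul, ← Matrix.mul_assoc,
    h.cov_left]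

lemma covMat_TS [IsProbabilityMeasure P] (h : IsCanonical P x y A B ρ) : covMat P (fun ω => Bᵀ *ᵥ y ω) (fun ω => Aᵀ *ᵥ x ω) = ρ • 1 := by
  rw [← covMat_transpose, h.covMat_ST, Matrix.transpose_smul, Matrix.transpose_one]

lemma memLp_smul_add_smul [IsProbabilityMeasure P] (h : IsCanonical P x y A B ρ) (c d : ℝ) (i : Fin r) :
    MemLp (fun ω => (c • (Aᵀ *ᵥ x ω) + d • (Bᵀ *ᵥ y ω)) i) 2 P :=
  ((h.memLp_S i).const_mul c).add ((h.memLp_T i).const_mul d)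

/-- Covariances of linear combinations of the canonical variables. -/
lemma covMat_smul_add_smul [IsProbabilityMeasure P] (h : IsCanonical P x y A B ρ) (c d c' d' : ℝ) :
    covMat P (fun ω => c • (Aᵀ *ᵥ x ω) + d • (Bᵀ *ᵥ y ω))
      (fun ω => c' • (Aᵀ *ᵥ x ω) + d' • (Bᵀ *ᵥ y ω)) =
      (c * c' + d * d' + (c * d' + d * c') * ρ) • 1 := by
  have hS : ∀ (c : ℝ) (i : Fin r), MemLp (fun ω => (c • (Aᵀ *ᵥ x ω)) i) 2 P :=
    fun c i => (h.memLp_S i).const_mul c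
  have hT : ∀ (c : ℝ) (i : Fin r), MemLp (fun ω => (c • (Bᵀ *ᵥ y ω)) i) 2 P :=
    fun c i => (h.memLp_T i).const_mul c
  rw [covMat_add_left (hS c) (hT d) (h.memLp_smul_add_smul c' d'),
    covMat_add_right (hS c) (hS c') (hT d'), covMat_add_right (hT d) (hS c') (hT d')]
  simp only [covMat_smul_left, covMat_smul_right, h.covMat_SS, h.covMat_TT, h.covMat_ST,
    h.covMat_TS, smul_smul, ← add_smul]
  congr 1
  ring

lemma integral_smul_add_smul [IsProbabilityMeasure P] (h : IsCanonical P x y A B ρ) (c d : ℝ) (i : Fin r) :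
    ∫ ω, (c • (Aᵀ *ᵥ x ω) + d • (Bᵀ *ᵥ y ω)) i ∂P = 0 := by
  simp only [Pi.add_apply, Pi.smul_apply, smul_eq_mul]
  rw [integral_add (((h.memLp_S i).integrable one_le_two).const_mul c)
    (((h.memLp_T i).integrable one_le_two).const_mul d), integral_const_mul, integral_const_mul,
    h.integral_S, h.integral_T]
  simp

lemma isLinearMap_smul_add_smul (A : Matrix (Fin p) (Fin r) ℝ)
    (B : Matrix (Fin q) (Fin r) ℝ) (c d : ℝ) : IsLinearMap ℝ
    (fun z : (Fin p → ℝ) × (Fin q → ℝ) => c • (Aᵀ *ᵥ z.1) + d • (Bᵀ *ᵥ z.2)) := by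
  constructor
  · intro z z'
    simp only [Prod.fst_add, Prod.snd_add, Matrix.mulVec_add, smul_add]
    abel
  · intro a z
    simp only [Prod.smul_fst, Prod.smul_snd, Matrix.mulVec_smul, smul_add, smul_comm a]

/-- The variance of a coordinate of `T - ρ S` is `1 - ρ²`, hence nonnegative. -/
lemma abs_le_one [IsProbabilityMeasure P] (h : IsCanonical P x y A B ρ) (hr : 1 ≤ r) : |ρ| ≤ 1 := by
  have h1 := congrFun (congrFun (h.covMat_smul_add_smul (-ρ) 1 (-ρ) 1) ⟨0, hr⟩) ⟨0, hr⟩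
  simp only [covMat, Matrix.of_apply, Matrix.smul_apply, Matrix.one_apply_eq, smul_eq_mul] at h1
  rw [covariance_self (h.memLp_smul_add_smul _ _ _).aestronglyMeasurable.aemeasurable] at h1
  have h2 := variance_nonneg (fun ω => (-ρ • (Aᵀ *ᵥ x ω) + (1 : ℝ) • (Bᵀ *ᵥ y ω)) ⟨0, hr⟩) P
  rw [h1] at h2
  rw [abs_le_one_iff_mul_self_le_one]
  linarith

/-- If the canonical correlations are `1`, then the canonical variables agree. -/
lemma ae_eq_of_eq_one [IsProbabilityMeasure P] (h : IsCanonical P x y A B ρ) (h1 : ρ = 1) (i : Fin r) :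
    ∀ᵐ ω ∂P, (Aᵀ *ᵥ x ω) i = (Bᵀ *ᵥ y ω) i := by
  have hc := congrFun (congrFun (h.covMat_smul_add_smul (-1) 1 (-1) 1) i) i
  simp only [covMat, Matrix.of_apply, Matrix.smul_apply, Matrix.one_apply_eq, smul_eq_mul] at hc
  have hm := h.memLp_smul_add_smul (-1) 1 i
  rw [covariance_self hm.aestronglyMeasurable.aemeasurable] at hc
  have hv : Var[fun ω => ((-1 : ℝ) • (Aᵀ *ᵥ x ω) + (1 : ℝ) • (Bᵀ *ᵥ y ω)) i; P] = 0 := by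
    rw [hc, h1]
    ring
  have hae := ae_eq_integral_of_variance_eq_zero hm hv
  rw [h.integral_smul_add_smul] at hae
  filter_upwards [hae] with ω hω
  simp only [Pi.add_apply, Pi.smul_apply, smul_eq_mul] at hω
  linarith

/-- The sum of quadratic forms appearing in the information density has a variance-gamma law. -/
lemma map_quadratic [IsProbabilityMeasure P] (h : IsCanonical P x y A B ρ) (hr : 1 ≤ r) (hρ : ρ ^ 2 < 1) :
    P.map (fun ω => ∑ i, (2 * ρ * (Aᵀ *ᵥ x ω) i * (Bᵀ *ᵥ y ω) i -
      ρ ^ 2 * ((Aᵀ *ᵥ x ω) i ^ 2 + (Bᵀ *ᵥ y ω) i ^ 2)) / (2 * (1 - ρ ^ 2))) =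
      varGamma ((r : ℝ) / 2) ρ := by
  have hp : 0 < 1 + ρ := by nlinarith
  have hm : 0 < 1 - ρ := by nlinarith
  -- The coordinates of `S + T` and `S - T` have variances `2 (1 + ρ)` and `2 (1 - ρ)` and are
  -- uncorrelated; `c` and `d` normalize them.
  set c : ℝ := (√(2 * (1 + ρ)))⁻¹ with hc
  set d : ℝ := (√(2 * (1 - ρ)))⁻¹ with hd
  have hc2 : c ^ 2 = (2 * (1 + ρ))⁻¹ := by rw [hc, inv_pow, Real.sq_sqrt (by positivity)]
  have hd2 : d ^ 2 = (2 * (1 - ρ))⁻¹ := by rw [hd, inv_pow, Real.sq_sqrt (by positivity)]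
  set U : Ω → Fin r ⊕ Fin r → ℝ := fun ω => Sum.elim (c • (Aᵀ *ᵥ x ω) + c • (Bᵀ *ᵥ y ω))
    (d • (Aᵀ *ᵥ x ω) + (-d) • (Bᵀ *ᵥ y ω)) with hU
  have hlin : IsLinearMap ℝ (fun z : (Fin p → ℝ) × (Fin q → ℝ) => (Sum.elim
      (c • (Aᵀ *ᵥ z.1) + c • (Bᵀ *ᵥ z.2)) (d • (Aᵀ *ᵥ z.1) + (-d) • (Bᵀ *ᵥ z.2)) :
        Fin r ⊕ Fin r → ℝ)) := by
    have h1 := isLinearMap_smul_add_smul A B c c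
    have h2 := isLinearMap_smul_add_smul A B d (-d)
    constructor
    · intro z z'
      ext i
      rcases i with i | i
      · exact congrFun (h1.map_add z z') i
      · exact congrFun (h2.map_add z z') i
    · intro a z
      ext i
      rcases i with i | i
      · exact congrFun (h1.map_smul a z) i
      · exact congrFun (h2.map_smul a z) i
  have hUg : HasGaussianLaw U P := h.comp_gaussian hlin
  have hU0 : ∀ i, ∫ ω, U ω i ∂P = 0 := by
    rintro (i | i)
    · exact h.integral_smul_add_smul c c i
    · exact h.integral_smul_add_smul d (-d) i
  have hU1 : covMat P U U = 1 := by
    have e1 : c * c + c * c + (c * c + c * c) * ρ = 1 := by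
      have : c * c = (2 * (1 + ρ))⁻¹ := by rw [← hc2, sq]
      rw [this]
      field_simp
      ring
    have e2 : d * d + -d * -d + (d * -d + -d * d) * ρ = 1 := by
      have : d * d = (2 * (1 - ρ))⁻¹ := by rw [← hd2, sq]
      rw [show d * d + -d * -d + (d * -d + -d * d) * ρ = d * d * (2 * (1 - ρ)) by ring, this]
      field_simp
    have e3 : c * d + c * -d + (c * -d + c * d) * ρ = 0 := by ring
    have e4 : d * c + -d * c + (d * c + -d * c) * ρ = 0 := by ring
    have k1 := h.covMat_smul_add_smul c c c c
    have k2 := h.covMat_smul_add_smul d (-d) d (-d)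
    have k3 := h.covMat_smul_add_smul c c d (-d)
    have k4 := h.covMat_smul_add_smul d (-d) c c
    rw [e1, one_smul] at k1
    rw [e2, one_smul] at k2
    rw [e3, zero_smul] at k3
    rw [e4, zero_smul] at k4
    calc covMat P U U = Matrix.fromBlocks _ _ _ _ := by
          ext i j
          rcases i with i | i <;> rcases j with j | j
          exacts [congrFun (congrFun k1 i) j, congrFun (congrFun k3 i) j,
            congrFun (congrFun k4 i) j, congrFun (congrFun k2 i) j]
      _ = 1 := Matrix.fromBlocks_one
  have hUm : ∀ i, AEMeasurable (fun ω => U ω i) P := fun i =>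
    (memLp_two_of_hasGaussianLaw hUg i).aestronglyMeasurable.aemeasurable
  rw [← map_sum_sq_sub_sq hr ρ (iIndepFun_of_covMat_eq_one hUg hU1) hUm
    (map_eval_of_covMat_eq_one hUg hU0 hU1)]
  congr 1
  ext ω
  refine Finset.sum_congr rfl fun i _ => ?_
  simp only [hU, Sum.elim_inl, Sum.elim_inr, Pi.add_apply, Pi.smul_apply, smul_eq_mul]
  generalize (Aᵀ *ᵥ x ω) i = s
  generalize (Bᵀ *ᵥ y ω) i = t
  -- The identity is `(2ρst - ρ²(s² + t²)) / (2(1 - ρ²)) = (ρ/2) (c²(s + t)² - d²(s - t)²)`.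
  rw [← mul_add, show d * s + -d * t = d * (s - t) by ring, mul_pow, mul_pow, hc2, hd2,
    show 1 - ρ ^ 2 = (1 + ρ) * (1 - ρ) by ring]
  field_simp
  ring

end IsCanonical

end CanonicalVariables

/-! ### From canonical variables to the information density. -/

section InformationDensity

open Matrix

namespace IsCanonical

variable {Ω : Type*} [MeasurableSpace Ω] {P : Measure Ω} {p q r : ℕ}
  {x : Ω → Fin p → ℝ} {y : Ω → Fin q → ℝ} {A : Matrix (Fin p) (Fin r) ℝ}
  {B : Matrix (Fin q) (Fin r) ℝ} {ρ : ℝ}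

/-- The part of `y` that is uncorrelated with the canonical variables. -/
def residual (P : Measure Ω) (B : Matrix (Fin q) (Fin r) ℝ) (y : Ω → Fin q → ℝ) (v : Fin q → ℝ) :
    Fin q → ℝ := v + (-(covMat P y y * B)) *ᵥ (Bᵀ *ᵥ v)

lemma residual_add (v w : Fin q → ℝ) :
    residual P B y (v + w) = residual P B y v + residual P B y w := by
  simp only [residual, Matrix.mulVec_add]
  abel

lemma residual_smul (a : ℝ) (v : Fin q → ℝ) :
    residual P B y (a • v) = a • residual P B y v := by
  simp only [residual, Matrix.mulVec_smul, smul_add]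

lemma memLp_residual (h : IsCanonical P x y A B ρ) (i : Fin q) :
    MemLp (fun ω => residual P B y (y ω) i) 2 P :=
  h.memLp (f := fun z => residual P B y z.2) ⟨fun _ _ => residual_add _ _,
    fun _ _ => residual_smul _ _⟩ i

lemma covMat_yx (h : IsCanonical P x y A B ρ) :
    covMat P y x = ρ • (covMat P y y * B * Aᵀ * covMat P x x) := by
  rw [← covMat_transpose, h.cov_cross]
  simp only [Matrix.transpose_smul, Matrix.transpose_mul, Matrix.transpose_transpose,
    covMat_transpose, Matrix.mul_assoc]

variable [IsProbabilityMeasure P]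

lemma covMat_residual_left (h : IsCanonical P x y A B ρ) {l : Type*} {V : Ω → l → ℝ}
    (hV : ∀ i, MemLp (fun ω => V ω i) 2 P) :
    covMat P (fun ω => residual P B y (y ω)) V =
      covMat P y V - covMat P y y * B * covMat P (fun ω => Bᵀ *ᵥ y ω) V := by
  have h2 : ∀ i, MemLp (fun ω => (-(covMat P y y * B) *ᵥ (Bᵀ *ᵥ y ω)) i) 2 P :=
    h.memLp (f := fun z => -(covMat P y y * B) *ᵥ (Bᵀ *ᵥ z.2))
      ⟨fun _ _ => by simp only [Prod.snd_add, Matrix.mulVec_add],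
        fun _ _ => by simp only [Prod.smul_snd, Matrix.mulVec_smul]⟩
  simp only [residual]
  rw [covMat_add_left h.memLp_y h2 hV, covMat_mulVec_left h.memLp_T hV, Matrix.neg_mul,
    sub_eq_add_neg]

lemma covMat_yT (h : IsCanonical P x y A B ρ) :
    covMat P y (fun ω => Bᵀ *ᵥ y ω) = covMat P y y * B := by
  rw [covMat_mulVec_right h.memLp_y h.memLp_y, Matrix.transpose_transpose]

lemma covMat_xS (h : IsCanonical P x y A B ρ) :
    covMat P x (fun ω => Aᵀ *ᵥ x ω) = covMat P x x * A := by
  rw [covMat_mulVec_right h.memLp_x h.memLp_x, Matrix.transpose_transpose]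

lemma covMat_yS (h : IsCanonical P x y A B ρ) :
    covMat P y (fun ω => Aᵀ *ᵥ x ω) = ρ • (covMat P y y * B) := by
  rw [covMat_mulVec_right h.memLp_y h.memLp_x, Matrix.transpose_transpose, h.covMat_yx,
    Matrix.smul_mul, Matrix.mul_assoc _ Aᵀ, Matrix.mul_assoc _ (Aᵀ * covMat P x x), h.cov_left,
    Matrix.mul_one]

lemma covMat_residual_T (h : IsCanonical P x y A B ρ) :
    covMat P (fun ω => residual P B y (y ω)) (fun ω => Bᵀ *ᵥ y ω) = 0 := by
  rw [h.covMat_residual_left h.memLp_T, h.covMat_TT, h.covMat_yT, Matrix.mul_one, sub_self]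

lemma covMat_residual_S (h : IsCanonical P x y A B ρ) :
    covMat P (fun ω => residual P B y (y ω)) (fun ω => Aᵀ *ᵥ x ω) = 0 := by
  rw [h.covMat_residual_left h.memLp_S, h.covMat_TS, h.covMat_yS, Matrix.mul_smul, Matrix.mul_one,
    sub_self]

/-- Since `R_yx = ρ R_y B Aᵀ R_x` and `Cov(T, x) = ρ Aᵀ R_x`, subtracting `R_y B T` from `y` removes
all correlation with `x`, not only that with `S`. -/
lemma covMat_x_residual (h : IsCanonical P x y A B ρ) :
    covMat P x (fun ω => residual P B y (y ω)) = 0 := by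
  rw [← covMat_transpose, h.covMat_residual_left h.memLp_x, ← covMat_transpose x
    (fun ω => Bᵀ *ᵥ y ω), h.covMat_xT, h.covMat_yx, Matrix.transpose_smul, Matrix.mul_smul,
    Matrix.transpose_mul, covMat_transpose, Matrix.mul_assoc _ Aᵀ, sub_self, Matrix.transpose_zero]

lemma covMat_smul_add_smul_right (h : IsCanonical P x y A B ρ) {l : Type*} {V : Ω → l → ℝ}
    (hV : ∀ i, MemLp (fun ω => V ω i) 2 P) (c d : ℝ) :
    covMat P V (fun ω => c • (Aᵀ *ᵥ x ω) + d • (Bᵀ *ᵥ y ω)) =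
      c • covMat P V (fun ω => Aᵀ *ᵥ x ω) + d • covMat P V (fun ω => Bᵀ *ᵥ y ω) := by
  rw [covMat_add_right hV (fun i => by exact (h.memLp_S i).const_mul c)
    (fun i => by exact (h.memLp_T i).const_mul d), covMat_smul_right, covMat_smul_right]

variable {E F : Type*} [MeasurableSpace E] [MeasurableSpace F] {X : Ω → E} {Y : Ω → F}
  {e : E ≃ᵐ (Fin p → ℝ)} {e' : F ≃ᵐ (Fin q → ℝ)}

/-- This is `map_prodMk_eq_withDensity` with `Z` the residual of `y` and `W = (T - ρ S) / √(1 -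
ρ²)`. The equivalences `e` and `e'` pass from the original vectors to their centered coordinates. -/
lemma map_eq_withDensity (h : IsCanonical P x y A B ρ) (hρ : ρ ^ 2 < 1)
    (hX : ∀ ω, e (X ω) = x ω) (hY : ∀ ω, e' (Y ω) = y ω) :
    P.map (fun ω => (X ω, Y ω)) = ((P.map X).prod (P.map Y)).withDensity fun z =>
      ∏ i, ENNReal.ofReal (corrDensity ρ ((Aᵀ *ᵥ e z.1) i) ((Bᵀ *ᵥ e' z.2) i)) := by
  have hσ : 0 < 1 - ρ ^ 2 := by linarith
  set σ := √(1 - ρ ^ 2) with hσdef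
  have hσ0 : 0 < σ := Real.sqrt_pos.2 hσ
  have hσ2 : σ ^ 2 = 1 - ρ ^ 2 := Real.sq_sqrt hσ.le
  set w : (Fin p → ℝ) × (Fin q → ℝ) → Fin r → ℝ :=
    fun z => (-ρ * σ⁻¹) • (Aᵀ *ᵥ z.1) + σ⁻¹ • (Bᵀ *ᵥ z.2) with hw
  have hwlin : IsLinearMap ℝ w := isLinearMap_smul_add_smul A B _ _
  have hmv : ∀ {m n : ℕ} (C : Matrix (Fin m) (Fin n) ℝ), Measurable fun v => C *ᵥ v :=
    fun C => (Continuous.matrix_mulVec continuous_const continuous_id).measurable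
  have hWW : covMat P (fun ω => w (x ω, y ω)) (fun ω => w (x ω, y ω)) = 1 := by
    simp only [hw]
    rw [h.covMat_smul_add_smul]
    have : -ρ * σ⁻¹ * (-ρ * σ⁻¹) + σ⁻¹ * σ⁻¹ + (-ρ * σ⁻¹ * σ⁻¹ + σ⁻¹ * (-ρ * σ⁻¹)) * ρ = 1 := by
      field_simp
      rw [hσ2]
      ring
    rw [this, one_smul]
  have hxW : covMat P x (fun ω => w (x ω, y ω)) = 0 := by
    simp only [hw]
    rw [h.covMat_smul_add_smul_right h.memLp_x, h.covMat_xS, h.covMat_xT, smul_smul, ← add_smul]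
    rw [show -ρ * σ⁻¹ + σ⁻¹ * ρ = 0 by ring, zero_smul]
  have hZW : covMat P (fun ω => residual P B y (y ω)) (fun ω => w (x ω, y ω)) = 0 := by
    simp only [hw]
    rw [h.covMat_smul_add_smul_right h.memLp_residual, h.covMat_residual_S, h.covMat_residual_T,
      smul_zero, smul_zero, add_zero]
  have hxm : AEMeasurable x P := by
    have := (h.comp_gaussian (f := Prod.fst) (LinearMap.fst ℝ _ _).isLinear).aemeasurable
    exact this
  have hXm : AEMeasurable X P := by
    have : X = fun ω => e.symm (x ω) := funext fun ω => by rw [← hX, e.symm_apply_apply]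
    rw [this]
    exact e.symm.measurable.comp_aemeasurable hxm
  refine map_prodMk_eq_withDensity hρ (L := fun u => Aᵀ *ᵥ e u) (L' := fun u => Bᵀ *ᵥ e' u)
    (h := fun u => e'.symm (u.1 + (covMat P y y * B) *ᵥ u.2))
    (Z := fun ω => residual P B y (y ω)) (W := fun ω => w (x ω, y ω)) (T := fun ω => Bᵀ *ᵥ y ω)
    ((hmv _).comp e.measurable) ((hmv _).comp e'.measurable)
    (e'.symm.measurable.comp (measurable_fst.add ((hmv _).comp measurable_snd))) hXm
    (h.comp_gaussian (f := fun z => residual P B y z.2)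
      ⟨fun _ _ => residual_add _ _, fun _ _ => residual_smul _ _⟩).aemeasurable
    (h.comp_gaussian hwlin).aemeasurable (fun ω => ?_) (fun ω => by rw [hY]) (fun ω => ?_) ?_ ?_ ?_
    ?_ ?_
  · rw [← hY, e'.eq_symm_apply, hY]
    simp only [residual, Matrix.neg_mulVec]
    abel
  · ext i
    simp only [hw, hX, Pi.add_apply, Pi.smul_apply, smul_eq_mul]
    field_simp
    ring
  -- Independence of `x` from the pair `(Z, W)` is more than independence from each; stacking the
  -- pair into one Gaussian family lets vanishing covariances prove it.
  · set f : (Fin p → ℝ) × (Fin q → ℝ) → (Fin p → ℝ) × (Fin q ⊕ Fin r → ℝ) :=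
      fun z => (z.1, Sum.elim (residual P B y z.2) (w z)) with hf
    have hflin : IsLinearMap ℝ f := by
      constructor
      · intro z z'
        refine Prod.ext rfl ?_
        ext i
        rcases i with i | i
        · exact congrFun (residual_add z.2 z'.2) i
        · exact congrFun (hwlin.map_add z z') i
      · intro a z
        refine Prod.ext rfl ?_
        ext i
        rcases i with i | i
        · exact congrFun (residual_smul a z.2) i
        · exact congrFun (hwlin.map_smul a z) i
    have hind : IndepFun x (fun ω => Sum.elim (residual P B y (y ω)) (w (x ω, y ω))) P := by
      refine indepFun_of_covMat_eq_zero (h.comp_gaussian hflin) ?_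
      ext i j
      rcases j with j | j
      · exact congrFun (congrFun h.covMat_x_residual i) j
      · exact congrFun (congrFun hxW i) j
    have hc := hind.comp (φ := e.symm) (ψ := fun v : Fin q ⊕ Fin r → ℝ =>
      (fun j => v (Sum.inl j), fun j => v (Sum.inr j))) e.symm.measurable (by fun_prop)
    convert! hc using 1
    ext ω
    rw [Function.comp, ← hX, e.symm_apply_apply]
  · refine indepFun_of_covMat_eq_zero (h.comp_gaussian (f := fun z => (residual P B y z.2, w z))
      ⟨fun z z' => Prod.ext (residual_add _ _) (hwlin.map_add z z'),
        fun a z => Prod.ext (residual_smul _ _) (hwlin.map_smul a z)⟩) hZW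
  · refine indepFun_of_covMat_eq_zero
      (h.comp_gaussian (f := fun z => (residual P B y z.2, Bᵀ *ᵥ z.2))
        ⟨fun z z' => Prod.ext (residual_add _ _) (by exact Matrix.mulVec_add _ z.2 z'.2),
          fun a z => Prod.ext (residual_smul _ _) (by exact Matrix.mulVec_smul _ a z.2)⟩)
      h.covMat_residual_T
  · exact map_eq_pi_of_covMat_eq_one (h.comp_gaussian hwlin) (h.integral_smul_add_smul _ _) hWW
  · exact map_eq_pi_of_covMat_eq_one (h.comp_gaussian (f := fun z => Bᵀ *ᵥ z.2)
      ⟨fun _ _ => Matrix.mulVec_add _ _ _, fun _ _ => Matrix.mulVec_smul _ _ _⟩) h.integral_T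
      h.covMat_TT

/-- Absolute continuity excludes perfect correlation. -/
lemma lt_one_of_absolutelyContinuous (h : IsCanonical P x y A B ρ) (hr : 1 ≤ r)
    (hX : ∀ ω, e (X ω) = x ω) (hY : ∀ ω, e' (Y ω) = y ω)
    (hac : P.map (fun ω => (X ω, Y ω)) ≪ (P.map X).prod (P.map Y)) : ρ < 1 := by
  refine lt_of_le_of_ne ((le_abs_self ρ).trans (h.abs_le_one hr)) fun h1 => ?_
  have hxm : AEMeasurable x P :=
    (h.comp_gaussian (f := Prod.fst) (LinearMap.fst ℝ _ _).isLinear).aemeasurable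
  have hym : AEMeasurable y P :=
    (h.comp_gaussian (f := Prod.snd) (LinearMap.snd ℝ _ _).isLinear).aemeasurable
  have hXm : AEMeasurable X P := by
    have : X = fun ω => e.symm (x ω) := funext fun ω => by rw [← hX, e.symm_apply_apply]
    rw [this]
    exact e.symm.measurable.comp_aemeasurable hxm
  have hYm : AEMeasurable Y P := by
    have : Y = fun ω => e'.symm (y ω) := funext fun ω => by rw [← hY, e'.symm_apply_apply]
    rw [this]
    exact e'.symm.measurable.comp_aemeasurable hym
  have hPY := Measure.isProbabilityMeasure_map hYm
  have hmv : ∀ {m n : ℕ} (C : Matrix (Fin m) (Fin n) ℝ) (i : Fin m),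
      Measurable fun v => (C *ᵥ v) i := fun C i =>
    (measurable_pi_apply i).comp
      (Continuous.matrix_mulVec continuous_const continuous_id).measurable
  set i : Fin r := ⟨0, hr⟩
  set f : E → ℝ := fun u => (Aᵀ *ᵥ e u) i
  set g : F → ℝ := fun u => (Bᵀ *ᵥ e' u) i
  have hf : Measurable f := (hmv Aᵀ i).comp e.measurable
  have hg : Measurable g := (hmv Bᵀ i).comp e'.measurable
  have hlaw : (P.map X).map f = gaussianReal 0 1 := by
    rw [AEMeasurable.map_map_of_aemeasurable hf.aemeasurable hXm]
    have := map_eval_of_covMat_eq_one (h.comp_gaussian (f := fun z => Aᵀ *ᵥ z.1)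
      ⟨fun _ _ => Matrix.mulVec_add _ _ _, fun _ _ => Matrix.mulVec_smul _ _ _⟩) h.integral_S
      h.covMat_SS i
    rw [← this]
    congr 1
    ext ω
    simp only [f, Function.comp, hX]
  -- The separating set is the event that the first canonical variables agree. The joint law gives
  -- it mass `1` when `ρ = 1`; under the product law it is null, because `f` has a law without
  -- atoms.
  have hD : MeasurableSet {z : E × F | f z.1 = g z.2} :=
    measurableSet_eq_fun (hf.comp measurable_fst) (hg.comp measurable_snd)
  have hatom := nullSingletonClass_gaussianReal (μ := 0) (v := 1) one_ne_zero
  have hnull : ((P.map X).prod (P.map Y)) {z : E × F | f z.1 = g z.2} = 0 := by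
    have hPX := Measure.isProbabilityMeasure_map hXm
    rw [Measure.prod_apply_symm hD]
    refine (lintegral_congr fun v => ?_).trans lintegral_zero
    have : (fun u => (u, v)) ⁻¹' {z : E × F | f z.1 = g z.2} = f ⁻¹' {g v} := by
      ext u
      simp
    rw [this, ← Measure.map_apply hf (measurableSet_singleton _), hlaw, measure_singleton]
  have h0 := hac hnull
  rw [Measure.map_apply_of_aemeasurable (hXm.prodMk hYm) hD] at h0
  have hall : ∀ᵐ ω ∂P, ω ∈ (fun ω => (X ω, Y ω)) ⁻¹' {z : E × F | f z.1 = g z.2} := by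
    filter_upwards [h.ae_eq_of_eq_one h1 i] with ω hω
    simp only [f, g, Set.mem_preimage, Set.mem_ofPred_eq, hX, hY, hω]
  have h2 := measure_eq_zero_iff_ae_notMem.1 h0
  obtain ⟨ω, hω1, hω2⟩ := (hall.and h2).exists
  exact hω2 hω1

lemma infoDensity_ae_eq (h : IsCanonical P x y A B ρ) (hρ : ρ ^ 2 < 1)
    (hX : ∀ ω, e (X ω) = x ω) (hY : ∀ ω, e' (Y ω) = y ω)
    (hXY : AEMeasurable (fun ω => (X ω, Y ω)) P) :
    infoDensity P X Y =ᵐ[P] fun ω => -((r : ℝ) / 2) * Real.log (1 - ρ ^ 2) +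
      ∑ i, (2 * ρ * (Aᵀ *ᵥ x ω) i * (Bᵀ *ᵥ y ω) i -
      ρ ^ 2 * ((Aᵀ *ᵥ x ω) i ^ 2 + (Bᵀ *ᵥ y ω) i ^ 2)) / (2 * (1 - ρ ^ 2)) := by
  have hσ : 0 < 1 - ρ ^ 2 := by linarith
  have hPX := Measure.isProbabilityMeasure_map (measurable_fst.comp_aemeasurable hXY)
  have hPY := Measure.isProbabilityMeasure_map (measurable_snd.comp_aemeasurable hXY)
  have hmv : ∀ {m n : ℕ} (C : Matrix (Fin m) (Fin n) ℝ) (i : Fin m),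
      Measurable fun v => (C *ᵥ v) i := fun C i =>
    (measurable_pi_apply i).comp
      (Continuous.matrix_mulVec continuous_const continuous_id).measurable
  have hd := h.map_eq_withDensity hρ hX hY
  have hm : Measurable fun z : E × F =>
      ∏ i, ENNReal.ofReal (corrDensity ρ ((Aᵀ *ᵥ e z.1) i) ((Bᵀ *ᵥ e' z.2) i)) :=
    Finset.measurable_fun_prod _ fun i _ => (measurable_corrDensity ρ
      ((hmv Aᵀ i).comp (e.measurable.comp measurable_fst))
      ((hmv Bᵀ i).comp (e'.measurable.comp measurable_snd))).ennreal_ofReal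
  have hrn : (P.map fun ω => (X ω, Y ω)).rnDeriv ((P.map X).prod (P.map Y))
      =ᵐ[P.map fun ω => (X ω, Y ω)] fun z : E × F =>
      ∏ i, ENNReal.ofReal (corrDensity ρ ((Aᵀ *ᵥ e z.1) i) ((Bᵀ *ᵥ e' z.2) i)) := by
    have h1 := Measure.rnDeriv_withDensity ((P.map X).prod (P.map Y)) hm
    rw [← hd] at h1
    -- The derivative is identified almost everywhere for the product measure; absolute continuity
    -- carries this over to the joint law, under which the information density is evaluated.
    refine Measure.AbsolutelyContinuous.ae_le ?_ h1
    rw [hd]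
    exact withDensity_absolutelyContinuous _ _
  filter_upwards [ae_of_ae_map hXY hrn] with ω hω
  rw [infoDensity, llr, hω, ENNReal.toReal_prod]
  simp_rw [ENNReal.toReal_ofReal (corrDensity_pos hρ _ _).le]
  rw [Real.log_prod fun i _ => (corrDensity_pos hρ _ _).ne']
  have hl : ∀ s t : ℝ, Real.log (corrDensity ρ s t) = -(1 / 2) * Real.log (1 - ρ ^ 2) +
      (2 * ρ * s * t - ρ ^ 2 * (s ^ 2 + t ^ 2)) / (2 * (1 - ρ ^ 2)) := by
    intro s t
    rw [corrDensity, Real.log_mul (by positivity) (Real.exp_pos _).ne', Real.log_exp, Real.log_inv,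
      Real.log_sqrt hσ.le]
    ring
  simp_rw [hl, hX, hY]
  rw [Finset.sum_add_distrib]
  simp only [Finset.sum_const, Finset.card_univ, Fintype.card_fin, nsmul_eq_mul]
  ring

end IsCanonical

end InformationDensity

/-! ### The canonical variables of the given vectors. -/

section CanonicalCorrelations

open Matrix

variable {Ω : Type*} [MeasurableSpace Ω] {P : Measure Ω} {p q : ℕ}

/-- The coordinates of a vector relative to the point `m`, as a measurable equivalence. -/
def centeredCoords (m : Fin p → ℝ) : EuclideanSpace ℝ (Fin p) ≃ᵐ (Fin p → ℝ) :=
  (MeasurableEquiv.toLp 2 (Fin p → ℝ)).symm.trans (MeasurableEquiv.subRight m)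

lemma centeredCoords_apply (m : Fin p → ℝ) (u : EuclideanSpace ℝ (Fin p)) (i : Fin p) :
    centeredCoords m u i = u i - m i := rfl

/-- The centered coordinates of a random vector. -/
def centered (P : Measure Ω) (X : Ω → EuclideanSpace ℝ (Fin p)) (ω : Ω) : Fin p → ℝ :=
  centeredCoords (fun i => ∫ ω', X ω' i ∂P) (X ω)

variable {X : Ω → EuclideanSpace ℝ (Fin p)} {Y : Ω → EuclideanSpace ℝ (Fin q)}

lemma memLp_coord (hX : HasGaussianLaw X P) (i : Fin p) : MemLp (fun ω => X ω i) 2 P :=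
  (hX.map_fun (EuclideanSpace.proj i : EuclideanSpace ℝ (Fin p) →L[ℝ] ℝ)).memLp_two

lemma hasGaussianLaw_centered (hXY : HasGaussianLaw (fun ω => (X ω, Y ω)) P) :
    HasGaussianLaw (fun ω => (centered P X ω, centered P Y ω)) P := by
  set c : (Fin p → ℝ) × (Fin q → ℝ) :=
    (fun i => -∫ ω', X ω' i ∂P, fun i => -∫ ω', Y ω' i ∂P) with hc
  have h1 := hXY.isLinearMap_comp (f := fun z => (WithLp.ofLp z.1, WithLp.ofLp z.2))
    ⟨fun _ _ => rfl, fun _ _ => rfl⟩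
  have h2 := h1.isGaussian_map
  refine ⟨?_⟩
  have e : P.map (fun ω => (centered P X ω, centered P Y ω)) =
      (P.map fun ω => ((X ω).ofLp, (Y ω).ofLp)).map fun z => z + c := by
    rw [AEMeasurable.map_map_of_aemeasurable (by fun_prop) h1.aemeasurable]
    congr 1
  rw [e]
  infer_instance

variable [IsProbabilityMeasure P]

lemma integral_centered (hX : HasGaussianLaw X P) (i : Fin p) :
    ∫ ω, centered P X ω i ∂P = 0 := by
  simp only [centered, centeredCoords_apply]
  rw [integral_sub ((memLp_coord hX i).integrable one_le_two) (integrable_const _)]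
  simp

lemma covMat_centered (hX : HasGaussianLaw X P) (hY : HasGaussianLaw Y P) :
    covMat P (centered P X) (centered P Y) = crossCov P X Y := by
  ext i j
  simp only [covMat, crossCov, Matrix.of_apply, centered, centeredCoords_apply]
  rw [covariance_sub_const_left ((memLp_coord hX i).integrable one_le_two),
    covariance_sub_const_right ((memLp_coord hY j).integrable one_le_two)]

/-- The quadratic form at `v` is the variance of the linear combination of coordinates with
coefficients `v`; a matrix with a single row expresses it through `covMat`. -/
lemma posSemidef_crossCov (hX : HasGaussianLaw X P) : (crossCov P X X).PosSemidef := by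
  have hm := memLp_coord hX
  refine Matrix.posSemidef_iff_dotProduct_mulVec.2 ⟨?_, fun v => ?_⟩
  · ext i j
    exact covariance_comm _ _
  · have h1 := covMat_mulVec_left (U := fun ω => (X ω).ofLp) (V := fun ω => (X ω).ofLp) hm hm
      (Matrix.of fun (_ : Unit) k => v k)
    have hs : ∀ i : Unit, MemLp (fun ω => ((Matrix.of fun (_ : Unit) k => v k) *ᵥ (X ω).ofLp) i)
        2 P := by
      intro i
      simp only [Matrix.mulVec, dotProduct]
      exact memLp_finsetSum _ fun k _ => (hm k).const_mul _
    have h2 := covMat_mulVec_right (U := fun ω => (Matrix.of fun (_ : Unit) k => v k) *ᵥ (X ω).ofLp)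
      (V := fun ω => (X ω).ofLp) hs hm (Matrix.of fun (_ : Unit) k => v k)
    rw [h1] at h2
    have h3 := congrFun (congrFun h2 ()) ()
    simp only [covMat, Matrix.of_apply] at h3
    rw [covariance_self (hs ()).aestronglyMeasurable.aemeasurable] at h3
    have h4 := variance_nonneg
      (fun ω => ((Matrix.of fun (_ : Unit) k => v k) *ᵥ (X ω).ofLp) ()) P
    rw [h3] at h4
    convert! h4 using 1
    rw [star_trivial, Matrix.dotProduct_mulVec]
    rfl

lemma exists_isCanonical (hXY : HasGaussianLaw (fun ω => (X ω, Y ω)) P)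
    (hX : (crossCov P X X).det ≠ 0) (hY : (crossCov P Y Y).det ≠ 0) {r : ℕ}
    (hr : r = (crossCov P X Y).rank) (hr1 : 1 ≤ r) {ρ : ℝ}
    (hρ : ∀ i : ℕ, i < r → canonicalCorr P X Y i = ρ) :
    0 < ρ ∧ ∃ (A : Matrix (Fin p) (Fin r) ℝ) (B : Matrix (Fin q) (Fin r) ℝ),
      IsCanonical P (centered P X) (centered P Y) A B ρ := by
  have hXg : HasGaussianLaw X P := hXY.fst
  have hYg : HasGaussianLaw Y P := hXY.snd
  obtain ⟨hρ0, A, B, hA, hB, hAB⟩ := exists_canonical (posSemidef_crossCov hXg)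
    (posSemidef_crossCov hYg) hX hY hr hr1 hρ
  refine ⟨hρ0, A, B, hasGaussianLaw_centered hXY, integral_centered hXg, integral_centered hYg,
    ?_, ?_, ?_⟩
  · rw [covMat_centered hXg hXg, hA]
  · rw [covMat_centered hYg hYg, hB]
  · rw [covMat_centered hXg hXg, covMat_centered hYg hYg, covMat_centered hXg hYg, hAB]

/-- For equal canonical correlations, the information density is a constant plus a variable with a
variance-gamma law. -/
lemma map_infoDensity_sub (hXY : HasGaussianLaw (fun ω => (X ω, Y ω)) P)
    (hX : (crossCov P X X).det ≠ 0) (hY : (crossCov P Y Y).det ≠ 0)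
    (hac : P.map (fun ω => (X ω, Y ω)) ≪ (P.map X).prod (P.map Y)) {r : ℕ}
    (hr : r = (crossCov P X Y).rank) (hr1 : 1 ≤ r) {ρ : ℝ}
    (hρ : ∀ i : ℕ, i < r → canonicalCorr P X Y i = ρ) :
    0 < ρ ∧ ρ < 1 ∧ AEMeasurable (infoDensity P X Y) P ∧
      P.map (fun ω => infoDensity P X Y ω - -((r : ℝ) / 2) * Real.log (1 - ρ ^ 2)) =
        varGamma ((r : ℝ) / 2) ρ := by
  obtain ⟨hρ0, A, B, h⟩ := exists_isCanonical hXY hX hY hr hr1 hρ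
  have hρ1 := h.lt_one_of_absolutelyContinuous (X := X) (Y := Y) hr1 (fun _ => rfl)
    (fun _ => rfl) hac
  have hρ2 : ρ ^ 2 < 1 := by nlinarith
  have hae := h.infoDensity_ae_eq (X := X) (Y := Y) hρ2 (fun _ => rfl) (fun _ => rfl)
    hXY.aemeasurable
  refine ⟨hρ0, hρ1, ?_, ?_⟩
  · refine AEMeasurable.congr ?_ hae.symm
    have hS := fun i => (h.memLp_S i).aestronglyMeasurable.aemeasurable
    have hT := fun i => (h.memLp_T i).aestronglyMeasurable.aemeasurable
    refine (Finset.aemeasurable_fun_sum _ fun i _ => ?_).const_add _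
    exact ((((hS i).const_mul _).mul (hT i)).sub ((((hS i).pow_const 2).add
      ((hT i).pow_const 2)).const_mul _)).div_const _
  · rw [← h.map_quadratic hr1 hρ2]
    refine Measure.map_congr ?_
    filter_upwards [hae] with ω hω
    rw [hω]
    ring

end CanonicalCorrelations

/-! ### Transfer from the variance-gamma law back to the random variable. -/

section Consequences

variable {Ω : Type*} [MeasurableSpace Ω] {P : Measure Ω} {Z : Ω → ℝ}
  {a ρ m : ℝ}

lemma integrable_sub_pow_of_map (ha : 0 < a) (hZ : AEMeasurable Z P)
    (hlaw : P.map (fun ω => Z ω - m) = varGamma a ρ) (k : ℕ) :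
    Integrable (fun ω => (Z ω - m) ^ k) P := by
  have h := integrable_pow_varGamma ha ρ k
  rw [← hlaw] at h
  exact (integrable_map_measure (continuous_pow k).aestronglyMeasurable (hZ.sub_const m)).1 h

lemma integral_sub_pow_of_map (hZ : AEMeasurable Z P)
    (hlaw : P.map (fun ω => Z ω - m) = varGamma a ρ) (k : ℕ) :
    ∫ ω, (Z ω - m) ^ k ∂P = ∫ x, x ^ k ∂varGamma a ρ := by
  rw [← hlaw, integral_map (hZ.sub_const m) (by fun_prop)]

lemma integrable_and_integral_of_map [IsProbabilityMeasure P] (ha : 0 < a) (hZ : AEMeasurable Z P)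
    (hlaw : P.map (fun ω => Z ω - m) = varGamma a ρ) : Integrable Z P ∧ ∫ ω, Z ω ∂P = m := by
  have h1 : Integrable (fun ω => Z ω - m) P := by
    simpa using integrable_sub_pow_of_map ha hZ hlaw 1
  have h2 := integral_sub_pow_of_map hZ hlaw 1
  -- The first moment vanishes by symmetry, which identifies the shift `m` as the mean.
  have h3 := integral_pow_odd_varGamma ha ρ 0
  simp only [mul_zero, zero_add] at h3
  rw [h3] at h2
  simp only [pow_one] at h2
  have h4 : Integrable Z P := by
    refine (h1.add (integrable_const m)).congr (ae_of_all _ fun ω => ?_)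
    simp
  rw [integral_sub h4 (integrable_const m)] at h2
  refine ⟨h4, ?_⟩
  simp only [integral_const, probReal_univ, one_smul] at h2
  linarith

lemma map_eq_withDensity_of_map_sub (ha : 0 < a) (hρ : 0 < ρ) (hZ : AEMeasurable Z P)
    (hlaw : P.map (fun ω => Z ω - m) = varGamma a ρ) :
    P.map Z = volume.withDensity fun x => ENNReal.ofReal (varGammaPDF a ρ (x - m)) := by
  have h1 : P.map Z = (varGamma a ρ).map fun x => x + m := by
    rw [← hlaw, AEMeasurable.map_map_of_aemeasurable (by fun_prop) (hZ.sub_const m)]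
    congr 1
    ext ω
    simp
  ext s hs
  have hs' : MeasurableSet ((fun x => x + m) ⁻¹' s) := measurable_add_const m hs
  rw [h1, Measure.map_apply (by fun_prop) hs, varGamma_eq_withDensity ha hρ,
    withDensity_apply _ hs', withDensity_apply _ hs, ← lintegral_indicator hs',
    ← lintegral_indicator hs, ← lintegral_add_right_eq_self (s.indicator _) m]
  refine lintegral_congr fun x => ?_
  by_cases hx : x + m ∈ s
  · rw [Set.indicator_of_mem (by exact hx), Set.indicator_of_mem hx, add_sub_cancel_right]
  · rw [Set.indicator_of_notMem (by exact hx), Set.indicator_of_notMem hx]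

lemma measureReal_le_of_map (hZ : AEMeasurable Z P)
    (hlaw : P.map (fun ω => Z ω - m) = varGamma a ρ) (x : ℝ) :
    P.real {ω | Z ω ≤ x} = (varGamma a ρ).real (Set.Iic (x - m)) := by
  rw [← hlaw, Measure.real, Measure.real, Measure.map_apply_of_aemeasurable (hZ.sub_const m)
    measurableSet_Iic]
  congr 2
  ext ω
  simp

end Consequences

end GaussInfo

end

open MeasureTheory ProbabilityTheory Filter Topology GaussInfo in
theorem corollary1 {Ω : Type*} [MeasurableSpace Ω] (P : Measure Ω) [IsProbabilityMeasure P]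
    {p q : ℕ} (X : Ω → EuclideanSpace ℝ (Fin p)) (Y : Ω → EuclideanSpace ℝ (Fin q))
    (hXY : HasGaussianLaw (fun ω => (X ω, Y ω)) P)
    (hX : (crossCov P X X).det ≠ 0) (hY : (crossCov P Y Y).det ≠ 0)
    (hac : P.map (fun ω => (X ω, Y ω)) ≪ (P.map X).prod (P.map Y))
    (r : ℕ) (hr : r = (crossCov P X Y).rank) (hr1 : 1 ≤ r)
    (ρ : ℝ) (hρ : ∀ i : ℕ, i < r → canonicalCorr P X Y i = ρ) :
    -- the mutual information
    (0 < ρ ∧ ρ < 1 ∧ Integrable (infoDensity P X Y) P ∧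
      mutualInfo P X Y = -((r : ℝ) / 2) * Real.log (1 - ρ ^ 2)) ∧
    -- (i) the probability density function
    (∃ f : ℝ → ℝ, Measurable f ∧ (∀ x, 0 ≤ f x) ∧
      P.map (infoDensity P X Y) = volume.withDensity (fun x => ENNReal.ofReal (f x)) ∧
      (∀ x, x ≠ mutualInfo P X Y →
        ContinuousAt f x ∧
        f x = 1 / (ρ * √Real.pi * Real.Gamma ((r : ℝ) / 2)) *
          besselK (((r : ℝ) - 1) / 2) |(x - mutualInfo P X Y) / ρ| *
          |(x - mutualInfo P X Y) / (2 * ρ)| ^ (((r : ℝ) - 1) / 2)) ∧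
      (2 ≤ r → ContinuousAt f (mutualInfo P X Y) ∧
        f (mutualInfo P X Y) =
          Real.Gamma (((r : ℝ) - 1) / 2) / (2 * ρ * √Real.pi * Real.Gamma ((r : ℝ) / 2)))) ∧
    -- (ii) the cumulative distribution function
    (Tendsto (equalCorrV r ρ) (𝓝[>] 0) (𝓝 0) ∧
      ∀ x : ℝ, P.real {ω | infoDensity P X Y ω ≤ x} =
        if x ≤ mutualInfo P X Y then 1 / 2 - equalCorrV r ρ (mutualInfo P X Y - x)
        else 1 / 2 + equalCorrV r ρ (x - mutualInfo P X Y)) ∧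
    -- (iii) the central moments
    ((∀ m : ℕ, Integrable (fun ω => (infoDensity P X Y ω - mutualInfo P X Y) ^ m) P) ∧
      (∀ k : ℕ, ∫ ω, (infoDensity P X Y ω - mutualInfo P X Y) ^ (2 * k) ∂P =
        ((2 * k).factorial : ℝ) / (k.factorial : ℝ) *
          (∏ j ∈ Finset.Icc 1 k, ((r : ℝ) / 2 + (j : ℝ) - 1)) * ρ ^ (2 * k)) ∧
      (∀ k : ℕ, ∫ ω, (infoDensity P X Y ω - mutualInfo P X Y) ^ (2 * k + 1) ∂P = 0)) := by
  obtain ⟨hρ0, hρ1, hm, hlaw⟩ := map_infoDensity_sub hXY hX hY hac hr hr1 hρ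
  have hr' : (1 : ℝ) ≤ r := by exact_mod_cast hr1
  have ha : 0 < (r : ℝ) / 2 := by positivity
  obtain ⟨hint, hI⟩ := integrable_and_integral_of_map ha hm hlaw
  have hI : mutualInfo P X Y = -((r : ℝ) / 2) * Real.log (1 - ρ ^ 2) := hI
  -- The additive constant is now the mutual information, so `varGamma` is the law of the centered
  -- information density.
  rw [← hI] at hlaw
  have hν : (r : ℝ) / 2 - 1 / 2 = ((r : ℝ) - 1) / 2 := by ring
  have hcont : ∀ x, ContinuousAt (varGammaPDF ((r : ℝ) / 2) ρ) (x - mutualInfo P X Y) →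
      ContinuousAt (fun x => varGammaPDF ((r : ℝ) / 2) ρ (x - mutualInfo P X Y)) x :=
    fun x hx => ContinuousAt.comp (f := fun x => x - mutualInfo P X Y) hx (by fun_prop)
  refine ⟨⟨hρ0, hρ1, hint, hI⟩,
    ⟨fun x => varGammaPDF ((r : ℝ) / 2) ρ (x - mutualInfo P X Y),
      (measurable_varGammaPDF _ hρ0).comp (measurable_sub_const _),
      fun x => varGammaPDF_nonneg (by linarith) hρ0 _,
      map_eq_withDensity_of_map_sub ha hρ0 hm hlaw, fun x hx => ⟨?_, ?_⟩, fun hr2 => ⟨?_, ?_⟩⟩,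
    ⟨tendsto_equalCorrV hr1 hρ0, fun x => ?_⟩,
    integrable_sub_pow_of_map ha hm hlaw, fun k => ?_, fun k => ?_⟩
  · exact hcont x (continuousAt_varGammaPDF hρ0 (sub_ne_zero.2 hx))
  · simp only
    rw [varGammaPDF_of_ne_zero _ _ (sub_ne_zero.2 hx), hν]
  · have hr2' : (2 : ℝ) ≤ r := by exact_mod_cast hr2
    refine hcont _ ?_
    rw [sub_self]
    -- Continuity at the centre needs shape `r / 2 > 1 / 2`, which is where `r ≥ 2` enters.
    exact continuousAt_varGammaPDF_zero (by linarith) hρ0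
  · simp only
    rw [sub_self, varGammaPDF, if_pos rfl, hν]
  · rw [measureReal_le_of_map hm hlaw, varGamma_real_Iic hr1 hρ0, neg_sub]
    simp only [sub_nonpos]
  · rw [integral_sub_pow_of_map hm hlaw, integral_pow_even_varGamma ha]
  · rw [integral_sub_pow_of_map hm hlaw, integral_pow_odd_varGamma ha]
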